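/- Let $\Gamma$ be a finite, connected, simple metric graph (no loops, no multiple edges) with $n\ge 2$ vertices $v_1,\dots,v_n$ and $N$ edges $e_1,\dots,e_N$, all of the same length $l_e>0$; each edge $e_i$ is identified with the interval $[0,l_e]$, its endpoints being its starting and its ending vertex. Let $\mathcal A$ be the adjacency matrix of $\Gamma$ and $\mathcal Z=\mathrm{Diag}(\mathcal A e)^{-1}\mathcal A$, with $e=(1,\dots,1)^{\top}$, its transition matrix. Let $L^{a/st}(\Gamma)$ be the anti-standard (anti-Kirchhoff) Laplacian: the operator $f\mapsto -f''$ in $L^2(\Gamma)=\bigoplus_{i=1}^{N} L^2[0,l_e]$ whose domain consists of all $f=(f_i)\in L^2(\Gamma)$ such that $f_i,f_i'$ are absolutely continuous on $[0,l_e]$ for each $i$, $f''\in L^2(\Gamma)$, and at every vertex $v$ the derivatives at $v$, taken in the outgoing direction along the edges incident to $v$, are all equal, while the values $f_i(v)$ along the edges incident to $v$ sum to $0$. (The scalars may be real or complex.) For real $\lambda$ let $m(\lambda)=\dim\ker(L^{a/st}(\Gamma)-\lambda)$. Then every $m(\lambda)$ is finite, and $$m(\lambda)=\begin{cases} N-n+1,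 & \lambda=0 \text{ and } \Gamma \text{ is bipartite},\\ N-n, & \lambda=0 \text{ and } \Gamma \text{ is non-bipartite},\\ \dim\ker\bigl(\mathcal Z+\cos(\sqrt\lambda\, l_e)I\bigr), & \lambda>0 \text{ and } \sin(\sqrt\lambda\, l_e)\neq 0,\\ N-n+2, & \lambda>0 \text{ and } \cos(\sqrt\lambda\, l_e)=-1,\\ N-n+2, & \lambda>0,\ \cos(\sqrt\lambda\, l_e)=1 \text{ and } \Gamma \text{ is bipartite},\\ N-n, & \lambda>0,\ \cos(\sqrt\lambda\, l_e)=1 \text{ and } \Gamma \text{ is non-bipartite}. \end{cases}$$ The spectrum of $L^{a/st}(\Gamma)$ is $$\sigma(L^{a/st}(\Gamma))=\{0\}\cup\{\lambda>0:-\cos(l_e\sqrt\lambda)\in\sigma(\mathcal Z)\}\cup\{\lambda>0:\cos(l_e\sqrt\lambda)=1\},$$ where a value whose multiplicity in the list above is $0$ is to be left out; that is, the first set is left out if $\Gamma$ is bipartite with $N=n-1$ (a tree), and the first and the third set are left out if $\Gamma$ is non-bipartite with $N=n$. -/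

import Mathlib

open MeasureTheory Set

noncomputable section

namespace QuantumGraph

/-! ### Unbounded operators: spectrum and eigenspaces -/

section Operators

variable {𝕜 H : Type*} [RCLike 𝕜] [NormedAddCommGroup H] [InnerProductSpace 𝕜 H]

/-- The spectrum of an unbounded operator `T` on a Hilbert space: the scalars `z` for which
`T - z` is not a bijection of its domain onto `H` with bounded inverse `R`. -/
def spectrumOf (T : H →ₗ.[𝕜] H) : Set 𝕜 :=
  {z | ¬ ∃ R : H →L[𝕜] H,
    (∀ g : H, ∃ h : R g ∈ T.domain, T ⟨R g, h⟩ - z • R g = g) ∧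
    ∀ f : T.domain, R (T f - z • (f : H)) = f}

/-- The kernel of `T - z`, as a subspace of the domain of `T`. -/
def eigenspaceOf (T : H →ₗ.[𝕜] H) (z : 𝕜) : Submodule 𝕜 T.domain :=
  LinearMap.ker (T.toFun - z • T.domain.subtype)

end Operators

/-! ### Metric graphs -/

/-- The simple graph on `V` underlying a family of edges with endpoints `o e` and `t e`. -/
def skeleton {V E : Type*} (o t : E → V) : SimpleGraph V :=
  SimpleGraph.fromRel fun v w => ∃ e, o e = v ∧ t e = w

/-- A connected simple metric graph with vertex set `V` and edge set `E` (both are taken finite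
in all uses): the edge `e` is the interval `[0, length e]`, where `0` is glued to the starting
vertex `o e` and `length e` to the ending vertex `t e`. -/
structure MetricGraph (V E : Type*) where
  o : E → V
  t : E → V
  loopless : ∀ e, o e ≠ t e
  simple : ∀ e e', s(o e, t e) = s(o e', t e') → e = e'
  length : E → ℝ
  length_pos : ∀ e, 0 < length e
  connected : (skeleton o t).Connected

namespace MetricGraph

variable {V E : Type*} (Γ : MetricGraph V E)

/-- The underlying combinatorial graph. -/
def graph : SimpleGraph V := skeleton Γ.o Γ.t

/-- All edges have the same length `ℓ`. -/
def IsEquilateral (ℓ : ℝ) : Prop := ∀ e, Γ.length e = ℓ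

open Classical in
/-- The adjacency matrix, with entries `0` and `1` read in `𝕜`. -/
def adjacency (𝕜 : Type*) [RCLike 𝕜] : Matrix V V 𝕜 := Γ.graph.adjMatrix 𝕜

/-- The transition matrix `Diag(A e)⁻¹ A`, where `e` is the all-ones vector. -/
def transition (𝕜 : Type*) [RCLike 𝕜] [Fintype V] [DecidableEq V] : Matrix V V 𝕜 :=
  (Matrix.diagonal (Matrix.mulVec (Γ.adjacency 𝕜) 1))⁻¹ * Γ.adjacency 𝕜

/-- The Hilbert space `L²(Γ) = ⨁ₑ L²[0, length e]`. -/
abbrev L2 (𝕜 : Type*) [RCLike 𝕜] [Fintype E] : Type _ :=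
  PiLp 2 fun e : E => Lp 𝕜 2 (volume.restrict (Icc 0 (Γ.length e)))

section Laplacian

variable {𝕜 : Type*} [RCLike 𝕜]

/-- `f` lies in the domain of the maximal Laplacian and `g = -f''`. On each edge `e` the
function `u e` is the continuous representative of `f` and `u' e` is its derivative (one-sided
at the endpoints). -/
structure IsMaxLaplacian [Fintype E] (f g : Γ.L2 𝕜) (u u' : E → ℝ → 𝕜) : Prop where
  ae_eq : ∀ e, (f e : ℝ → 𝕜) =ᵐ[volume.restrict (Icc 0 (Γ.length e))] u e
  ac : ∀ e, AbsolutelyContinuousOnInterval (u e) 0 (Γ.length e)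
  hasDeriv : ∀ e, ∀ x ∈ Icc 0 (Γ.length e), HasDerivWithinAt (u e) (u' e x) (Icc 0 (Γ.length e)) x
  ac_deriv : ∀ e, AbsolutelyContinuousOnInterval (u' e) 0 (Γ.length e)
  hasDeriv_deriv : ∀ e, ∀ᵐ x ∂volume.restrict (Icc 0 (Γ.length e)),
    HasDerivAt (u' e) (-(g e : ℝ → 𝕜) x) x

open Classical in
/-- The value at the vertex `v` along the edge `e` (`0` if `e` is not incident to `v`). -/
def valueAt (u : E → ℝ → 𝕜) (v : V) (e : E) : 𝕜 :=
  if Γ.o e = v then u e 0 else if Γ.t e = v then u e (Γ.length e) else 0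

open Classical in
/-- The outgoing derivative at the vertex `v` along the edge `e`, for a function with
derivative `u'` (`0` if `e` is not incident to `v`). -/
def outDerivAt (u' : E → ℝ → 𝕜) (v : V) (e : E) : 𝕜 :=
  if Γ.o e = v then u' e 0 else if Γ.t e = v then -u' e (Γ.length e) else 0

/-- The anti-standard (anti-Kirchhoff) vertex conditions: at each vertex the outgoing
derivatives along the incident edges coincide and the values sum to zero. -/
structure AntiStandard [Fintype E] (u u' : E → ℝ → 𝕜) : Prop where
  deriv_eq : ∀ v e e', (Γ.o e = v ∨ Γ.t e = v) → (Γ.o e' = v ∨ Γ.t e' = v) →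
    Γ.outDerivAt u' v e = Γ.outDerivAt u' v e'
  sum_eq_zero : ∀ v, ∑ e, Γ.valueAt u v e = 0

variable {Γ}

theorem valueAt_add (u w : E → ℝ → 𝕜) (v : V) (e : E) :
    Γ.valueAt (u + w) v e = Γ.valueAt u v e + Γ.valueAt w v e := by
  unfold valueAt; split_ifs <;> simp

theorem valueAt_smul (c : 𝕜) (u : E → ℝ → 𝕜) (v : V) (e : E) :
    Γ.valueAt (c • u) v e = c * Γ.valueAt u v e := by
  unfold valueAt; split_ifs <;> simp

theorem outDerivAt_add (u w : E → ℝ → 𝕜) (v : V) (e : E) :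
    Γ.outDerivAt (u + w) v e = Γ.outDerivAt u v e + Γ.outDerivAt w v e := by
  unfold outDerivAt; split_ifs <;> simp [add_comm]

theorem outDerivAt_smul (c : 𝕜) (u : E → ℝ → 𝕜) (v : V) (e : E) :
    Γ.outDerivAt (c • u) v e = c * Γ.outDerivAt u v e := by
  unfold outDerivAt; split_ifs <;> simp

theorem AntiStandard.add [Fintype E] {u u' w w' : E → ℝ → 𝕜} (h : Γ.AntiStandard u u')
    (k : Γ.AntiStandard w w') : Γ.AntiStandard (u + w) (u' + w') where
  deriv_eq v e e' he he' := by
    rw [outDerivAt_add, outDerivAt_add, h.deriv_eq v e e' he he', k.deriv_eq v e e' he he']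
  sum_eq_zero v := by
    simp only [valueAt_add, Finset.sum_add_distrib, h.sum_eq_zero, k.sum_eq_zero, add_zero]

theorem AntiStandard.smul [Fintype E] {u u' : E → ℝ → 𝕜} (c : 𝕜) (h : Γ.AntiStandard u u') :
    Γ.AntiStandard (c • u) (c • u') where
  deriv_eq v e e' he he' := by
    rw [outDerivAt_smul, outDerivAt_smul, h.deriv_eq v e e' he he']
  sum_eq_zero v := by
    simp only [valueAt_smul, ← Finset.mul_sum, h.sum_eq_zero, mul_zero]

theorem IsMaxLaplacian.add [Fintype E] {f g f₁ g₁ : Γ.L2 𝕜} {u u' w w' : E → ℝ → 𝕜}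
    (h : Γ.IsMaxLaplacian f g u u') (k : Γ.IsMaxLaplacian f₁ g₁ w w') :
    Γ.IsMaxLaplacian (f + f₁) (g + g₁) (u + w) (u' + w') where
  ae_eq e := (Lp.coeFn_add (f e) (f₁ e)).trans ((h.ae_eq e).add (k.ae_eq e))
  ac e := (h.ac e).add (k.ac e)
  hasDeriv e x hx := (h.hasDeriv e x hx).add (k.hasDeriv e x hx)
  ac_deriv e := (h.ac_deriv e).add (k.ac_deriv e)
  hasDeriv_deriv e := by
    filter_upwards [h.hasDeriv_deriv e, k.hasDeriv_deriv e, Lp.coeFn_add (g e) (g₁ e)]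
      with x h1 h2 h3
    have := h1.add h2
    rw [← neg_add] at this
    rw [PiLp.add_apply, h3]
    exact this

theorem IsMaxLaplacian.smul [Fintype E] {f g : Γ.L2 𝕜} {u u' : E → ℝ → 𝕜} (c : 𝕜)
    (h : Γ.IsMaxLaplacian f g u u') :
    Γ.IsMaxLaplacian (c • f) (c • g) (c • u) (c • u') where
  ae_eq e := (Lp.coeFn_smul c (f e)).trans ((h.ae_eq e).const_smul c)
  ac e := (h.ac e).const_smul c
  hasDeriv e x hx := (h.hasDeriv e x hx).const_smul c
  ac_deriv e := (h.ac_deriv e).const_smul c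
  hasDeriv_deriv e := by
    filter_upwards [h.hasDeriv_deriv e, Lp.coeFn_smul c (g e)] with x h1 h2
    have := h1.const_smul c
    rw [smul_neg] at this
    rw [PiLp.smul_apply, h2]
    exact this

theorem IsMaxLaplacian.zero [Fintype E] : Γ.IsMaxLaplacian (0 : Γ.L2 𝕜) 0 0 0 where
  ae_eq e := Lp.coeFn_zero _ _ _
  ac e := (contDiffOn_const (c := (0 : 𝕜))).absolutelyContinuousOnInterval
  hasDeriv e x hx := hasDerivWithinAt_const x _ 0
  ac_deriv e := (contDiffOn_const (c := (0 : 𝕜))).absolutelyContinuousOnInterval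
  hasDeriv_deriv e := by
    filter_upwards [Lp.coeFn_zero 𝕜 2 (volume.restrict (Icc 0 (Γ.length e)))] with x hx
    have h0 : -((0 : ℝ → 𝕜) x) = 0 := neg_zero
    rw [PiLp.zero_apply, hx, h0]
    exact hasDerivAt_const x (0 : 𝕜)

variable (Γ 𝕜)

/-- The graph of the anti-standard Laplacian: the pairs `(f, -f'')` with `f` in the domain of
the maximal Laplacian satisfying the anti-standard conditions. -/
def antiStandardGraph [Fintype E] : Submodule 𝕜 (Γ.L2 𝕜 × Γ.L2 𝕜) where
  carrier := {p | ∃ u u' : E → ℝ → 𝕜, Γ.IsMaxLaplacian p.1 p.2 u u' ∧ Γ.AntiStandard u u'}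
  zero_mem' := ⟨0, 0, IsMaxLaplacian.zero,
    ⟨fun v e e' _ _ => by simp [outDerivAt], fun v => by simp [valueAt]⟩⟩
  add_mem' := by
    rintro p q ⟨u, u', h, a⟩ ⟨w, w', k, b⟩
    exact ⟨u + w, u' + w', h.add k, a.add b⟩
  smul_mem' := by
    rintro c p ⟨u, u', h, a⟩
    exact ⟨c • u, c • u', h.smul c, a.smul c⟩

/-- The anti-standard (anti-Kirchhoff) Laplacian `f ↦ -f''` as an unbounded operator in
`L²(Γ)`. -/
def antiStandardLaplacian [Fintype E] : Γ.L2 𝕜 →ₗ.[𝕜] Γ.L2 𝕜 :=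
  (Γ.antiStandardGraph 𝕜).toLinearPMap

variable {Γ 𝕜}

theorem IsMaxLaplacian.eq_zero [Fintype E] {f g : Γ.L2 𝕜} {u u' : E → ℝ → 𝕜}
    (h : Γ.IsMaxLaplacian f g u u') (hf : f = 0) : g = 0 := by
  subst hf
  refine PiLp.ext fun e => ?_
  have hl := Γ.length_pos e
  set l := Γ.length e with hl_def
  have hu : ∀ x ∈ Icc 0 l, u e x = 0 := by
    have h0 : u e =ᵐ[volume.restrict (Icc 0 l)] fun _ => (0 : 𝕜) :=
      (h.ae_eq e).symm.trans (Lp.coeFn_zero _ _ _)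
    have hc : ContinuousOn (u e) (Icc 0 l) := fun x hx =>
      (h.hasDeriv e x hx).continuousWithinAt
    exact Measure.eqOn_Icc_of_ae_eq volume hl.ne h0 hc continuousOn_const
  have hu' : ∀ x ∈ Icc 0 l, u' e x = 0 := fun x hx =>
    (uniqueDiffOn_Icc hl x hx).eq_deriv _ (h.hasDeriv e x hx)
      ((hasDerivWithinAt_const x _ (0 : 𝕜)).congr (fun y hy => hu y hy) (hu x hx))
  refine Lp.ext ?_
  have hI : ∀ᵐ x ∂volume.restrict (Icc 0 l), x ∈ Ioo 0 l := by
    rw [← restrict_Ioo_eq_restrict_Icc]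
    exact ae_restrict_mem measurableSet_Ioo
  filter_upwards [h.hasDeriv_deriv e, hI, Lp.coeFn_zero 𝕜 2 (volume.restrict (Icc 0 l))]
    with x h1 h2 h3
  rw [PiLp.zero_apply, h3]
  have h4 : HasDerivAt (u' e) 0 x := by
    refine (hasDerivAt_const x (0 : 𝕜)).congr_of_eventuallyEq ?_
    filter_upwards [Icc_mem_nhds h2.1 h2.2] with y hy using hu' y hy
  simpa using h1.unique h4

/-- The relation `antiStandardGraph` is indeed the graph of `antiStandardLaplacian`. -/
theorem antiStandardLaplacian_graph [Fintype E] :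
    (Γ.antiStandardLaplacian 𝕜).graph = Γ.antiStandardGraph 𝕜 :=
  Submodule.toLinearPMap_graph_eq _ fun _ hp h0 => by
    obtain ⟨u, u', h, -⟩ := hp
    exact h.eq_zero h0

/-- The domain of the anti-standard Laplacian. -/
theorem mem_antiStandardLaplacian_domain [Fintype E] {f : Γ.L2 𝕜} :
    f ∈ (Γ.antiStandardLaplacian 𝕜).domain ↔
      ∃ (g : Γ.L2 𝕜) (u u' : E → ℝ → 𝕜), Γ.IsMaxLaplacian f g u u' ∧ Γ.AntiStandard u u' := by
  simp [antiStandardLaplacian, Submodule.toLinearPMap_domain, antiStandardGraph]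

end Laplacian

end MetricGraph

end QuantumGraph

end

noncomputable section

namespace QuantumGraph

/-! ### Analysis on a single edge -/

section Interval

variable {𝕜 : Type*} [RCLike 𝕜]

/-! On each edge the solutions of `-u'' = z u` are the combinations `a c + b s` of a fundamental
system. Equality of the outgoing derivatives at the vertices means that they come from a vertex
function `φ`: `u' = φ ∘ o` at starting points and `u' = -φ ∘ t` at ending points. Together with the
vanishing sums of the values this is a homogeneous square linear system in `(a, b, φ)`, the kernel
of `boundaryMap`, and `eigenspaceEquiv` identifies it with the eigenspace.

The kernel is then computed case by case. If `λ > 0` and the sine at `ℓ` is nonzero, `φ` determines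
`a` and `b`, and the sum condition becomes `(A + cos • D) φ = 0` with `D` the degree matrix, that
is, `φ ∈ ker (Z + cos)`. If the sine vanishes and the cosine is `σ = ±1`, then `a` and `φ` decouple:
`a` lies in the kernel of the incidence operator of weight `σ` and `φ` in the kernel of its
transpose. These two dimensions differ by `N - n` (`finrank_ker_incidence`), and the transpose
kernel has dimension `d`, giving `N - n + 2d`; connectedness gives `d = 1` for `σ = -1`, while for
`σ = 1` it gives `d = 1` or `0` according as the graph is bipartite or not. At `λ = 0` an energy
argument kills `b` and `φ`, leaving one incidence kernel and `N - n + d`.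

The spectrum consists of eigenvalues only. The inhomogeneous equation reduces to the same square
system, so injectivity of `T - z` implies surjectivity (`exists_sub_smul_eq`), and symmetry of `T`
makes the inverse bounded (`notMem_spectrumOf_of_bijective`). The quadratic form `∑ ∫ |u'|²`
confines the eigenvalues to `[0, ∞)`. -/

theorem _root_.AbsolutelyContinuousOnInterval.comp_isometry {X Y : Type*} [PseudoMetricSpace X]
    [PseudoMetricSpace Y] {f : ℝ → X} {a b : ℝ} (hf : AbsolutelyContinuousOnInterval f a b)
    {φ : X → Y} (hφ : Isometry φ) : AbsolutelyContinuousOnInterval (fun x => φ (f x)) a b := by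
  rw [absolutelyContinuousOnInterval_iff] at hf ⊢
  simpa only [hφ.dist_eq] using hf

/-- The primitive of an integrable function is absolutely continuous. -/
theorem absolutelyContinuousOnInterval_primitive {f : ℝ → 𝕜} {a b : ℝ}
    (h : IntervalIntegrable f volume a b) :
    AbsolutelyContinuousOnInterval (fun x => ∫ t in a..x, f t) a b := by
  have hre : IntervalIntegrable (fun t => RCLike.re (f t)) volume a b :=
    ⟨h.1.re, h.2.re⟩
  have him : IntervalIntegrable (fun t => RCLike.im (f t)) volume a b :=
    ⟨h.1.im, h.2.im⟩
  have iso : Isometry ((↑) : ℝ → 𝕜) :=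
    AddMonoidHomClass.isometry_of_norm (RCLike.ofRealAm (K := 𝕜)) fun x => RCLike.norm_ofReal x
  have h1 := (hre.absolutelyContinuousOnInterval_intervalIntegral left_mem_uIcc).comp_isometry iso
  have h2 := ((him.absolutelyContinuousOnInterval_intervalIntegral
    left_mem_uIcc).comp_isometry iso).const_smul (RCLike.I : 𝕜)
  have h3 := h1.add h2
  rw [absolutelyContinuousOnInterval_iff] at h3 ⊢
  have key : ∀ x ∈ uIcc a b, ∫ t in a..x, f t = ((fun x => ((∫ t in a..x, RCLike.re (f t) : ℝ) : 𝕜))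
      + fun x => (RCLike.I : 𝕜) • ((∫ t in a..x, RCLike.im (f t) : ℝ) : 𝕜)) x := by
    intro x hx
    have hx' : IntervalIntegrable f volume a x :=
      h.mono_set (uIcc_subset_uIcc_left hx)
    simp only [Pi.add_apply, smul_eq_mul]
    have e1 := (RCLike.ofRealCLM (K := 𝕜)).intervalIntegral_comp_comm
      (show IntervalIntegrable (fun t => RCLike.re (f t)) volume a x from ⟨hx'.1.re, hx'.2.re⟩)
    have e2 := (RCLike.ofRealCLM (K := 𝕜)).intervalIntegral_comp_comm
      (show IntervalIntegrable (fun t => RCLike.im (f t)) volume a x from ⟨hx'.1.im, hx'.2.im⟩)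
    simp only [RCLike.ofRealCLM_apply] at e1 e2
    rw [← e1, ← e2, ← intervalIntegral.integral_const_mul, ← intervalIntegral.integral_add]
    · refine intervalIntegral.integral_congr fun t _ => ?_
      simpa [mul_comm] using (RCLike.re_add_im (f t)).symm
    · exact ⟨hx'.1.re.ofReal, hx'.2.re.ofReal⟩
    · exact (IntervalIntegrable.const_mul ⟨hx'.1.im.ofReal, hx'.2.im.ofReal⟩ _)
  intro ε hε
  obtain ⟨δ, hδ, H⟩ := h3 ε hε
  refine ⟨δ, hδ, fun E hE hE' => ?_⟩
  refine lt_of_eq_of_lt (Finset.sum_congr rfl fun i hi => ?_) (H E hE hE')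
  have := hE.1 i (by simpa using hi)
  rw [key _ this.1, key _ this.2]

/-- The fundamental theorem of calculus for absolutely continuous functions. -/
theorem integral_eq_sub_of_ae_hasDerivAt {f g : ℝ → 𝕜} {l : ℝ} (hl : 0 < l)
    (hf : AbsolutelyContinuousOnInterval f 0 l) (hg : IntervalIntegrable g volume 0 l)
    (h : ∀ᵐ x ∂volume.restrict (Icc 0 l), HasDerivAt f (g x) x) {x : ℝ} (hx : x ∈ Icc 0 l) :
    ∫ t in (0 : ℝ)..x, g t = f x - f 0 := by
  -- `f` minus the primitive of `g` is absolutely continuous with derivative zero almost everywhere,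
  -- hence constant.
  have hac := hf.sub (absolutelyContinuousOnInterval_primitive hg)
  rw [ae_restrict_iff' measurableSet_Icc] at h
  obtain ⟨C, hC⟩ := hac.const_of_ae_hasDerivAt_zero (by
    filter_upwards [h, hg.ae_hasDerivAt_integral] with y h1 h2 hy
    have := (h1 (by rwa [uIcc_of_le hl.le] at hy)).sub (h2 hy 0 left_mem_uIcc)
    rwa [sub_self] at this)
  have e1 := hC x (by rwa [uIcc_of_le hl.le])
  have e0 := hC 0 left_mem_uIcc
  simp only [Pi.sub_apply, intervalIntegral.integral_same, sub_zero] at e1 e0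
  rw [e0, ← e1]; ring

theorem ae_mem_Ioo (l : ℝ) : ∀ᵐ x ∂volume.restrict (Icc 0 l), x ∈ Ioo 0 l := by
  rw [← restrict_Ioo_eq_restrict_Icc]
  exact ae_restrict_mem measurableSet_Ioo

theorem intervalIntegrable_of_L2 {l : ℝ} (hl : 0 < l)
    (g : Lp 𝕜 2 (volume.restrict (Icc 0 l))) : IntervalIntegrable (g : ℝ → 𝕜) volume 0 l := by
  rw [intervalIntegrable_iff_integrableOn_Icc_of_le hl.le]
  exact (Lp.memLp g).integrable (by norm_num)

theorem memLp_of_continuousOn {l : ℝ} {u : ℝ → 𝕜} (hu : ContinuousOn u (Icc 0 l)) :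
    MemLp u 2 (volume.restrict (Icc 0 l)) := by
  obtain ⟨C, hC⟩ := isCompact_Icc.exists_bound_of_continuousOn hu
  refine MemLp.of_bound (hu.aestronglyMeasurable measurableSet_Icc) C ?_
  exact (ae_restrict_iff' measurableSet_Icc).2 (Filter.Eventually.of_forall hC)

/-- A fundamental system `c, s` of `u'' = -z u`, with `c' = -z s` and `s' = c`. -/
structure IsFundamental (z : 𝕜) (c s : ℝ → 𝕜) : Prop where
  hc : ∀ x, HasDerivAt c (-z * s x) x
  hs : ∀ x, HasDerivAt s (c x) x
  c0 : c 0 = 1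
  s0 : s 0 = 0

theorem IsFundamental.wronskian {z : 𝕜} {c s : ℝ → 𝕜} (h : IsFundamental z c s) (x : ℝ) :
    c x * c x + z * (s x * s x) = 1 := by
  have hd : ∀ x, HasDerivAt (fun x => c x * c x + z * (s x * s x)) 0 x := fun x => by
    refine (((h.hc x).mul (h.hc x)).add (((h.hs x).mul (h.hs x)).const_mul z)).congr_deriv ?_
    ring
  have := is_const_of_deriv_eq_zero (fun x => (hd x).differentiableAt) (fun x => (hd x).deriv) x 0
  simpa [h.c0, h.s0] using this

/-- The pair `(c, s)` solves a linear first-order system with constant generator `A`, so it is `exp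
(t A)` applied to `(1, 0)`. This covers every scalar `z` without choosing a square root. -/
theorem exists_isFundamental (z : 𝕜) : ∃ c s : ℝ → 𝕜, IsFundamental z c s := by
  let A : (𝕜 × 𝕜) →L[ℝ] 𝕜 × 𝕜 :=
    ((-z) • ContinuousLinearMap.snd ℝ 𝕜 𝕜).prod (ContinuousLinearMap.fst ℝ 𝕜 𝕜)
  let y : ℝ → 𝕜 × 𝕜 := fun t => NormedSpace.exp (t • A) (1, 0)
  have hy : ∀ t, HasDerivAt y (A (y t)) t := fun t => by
    have h := hasDerivAt_exp_smul_const' (𝕂 := ℝ) A t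
    exact (ContinuousLinearMap.apply ℝ (𝕜 × 𝕜) ((1, 0) : 𝕜 × 𝕜)).hasFDerivAt.comp_hasDerivAt t h
  have h0 : y 0 = (1, 0) := by
    have h1 : NormedSpace.exp ((0 : ℝ) • A) = 1 := by
      rw [show (0 : ℝ) • A = 0 from zero_smul ℝ A]
      exact NormedSpace.exp_zero
    simp only [y, h1, one_apply_eq_self]
  refine ⟨fun t => (y t).1, fun t => (y t).2, fun t => ?_, fun t => ?_, ?_, ?_⟩
  · exact (ContinuousLinearMap.fst ℝ 𝕜 𝕜).hasFDerivAt.comp_hasDerivAt t (hy t)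
  · exact (ContinuousLinearMap.snd ℝ 𝕜 𝕜).hasFDerivAt.comp_hasDerivAt t (hy t)
  · simp [h0]
  · simp [h0]

theorem isFundamental_zero : IsFundamental (0 : 𝕜) (fun _ => 1) (fun x => (x : 𝕜)) where
  hc x := by simpa using hasDerivAt_const x (1 : 𝕜)
  hs x := by simpa using (RCLike.ofRealCLM (K := 𝕜)).hasDerivAt (x := x)
  c0 := rfl
  s0 := by simp

theorem isFundamental_trig {μ : ℝ} (hμ : 0 < μ) :
    IsFundamental (μ : 𝕜) (fun x => ((Real.cos (√μ * x) : ℝ) : 𝕜))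
      (fun x => ((Real.sin (√μ * x) / √μ : ℝ) : 𝕜)) where
  hc x := by
    have hk := Real.sqrt_pos.2 hμ
    have h1 : HasDerivAt (fun x => Real.cos (√μ * x)) (-μ * (Real.sin (√μ * x) / √μ)) x := by
      refine ((Real.hasDerivAt_cos _).comp x ((hasDerivAt_id x).const_mul √μ)).congr_deriv ?_
      nth_rewrite 3 [← Real.mul_self_sqrt hμ.le]
      field_simp
      rfl
    exact (RCLike.ofRealCLM (K := 𝕜)).hasFDerivAt.comp_hasDerivAt x h1 |>.congr_deriv (by simp)
  hs x := by
    have hk := Real.sqrt_pos.2 hμ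
    have h1 : HasDerivAt (fun x => Real.sin (√μ * x) / √μ) (Real.cos (√μ * x)) x := by
      refine (((Real.hasDerivAt_sin _).comp x
        ((hasDerivAt_id x).const_mul √μ)).div_const √μ).congr_deriv ?_
      field_simp
      rfl
    exact (RCLike.ofRealCLM (K := 𝕜)).hasFDerivAt.comp_hasDerivAt x h1
  c0 := by simp
  s0 := by simp

theorem IsFundamental.continuous_c {z : 𝕜} {c s : ℝ → 𝕜} (h : IsFundamental z c s) :
    Continuous c := continuous_iff_continuousAt.2 fun x => (h.hc x).continuousAt

theorem IsFundamental.continuous_s {z : 𝕜} {c s : ℝ → 𝕜} (h : IsFundamental z c s) :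
    Continuous s := continuous_iff_continuousAt.2 fun x => (h.hs x).continuousAt

theorem absolutelyContinuousOnInterval_of_hasDerivAt {f f' : ℝ → 𝕜} (hf : ∀ x, HasDerivAt f (f' x) x)
    (hf' : Continuous f') (a b : ℝ) : AbsolutelyContinuousOnInterval f a b := by
  refine ContDiffOn.absolutelyContinuousOnInterval (ContDiff.contDiffOn ?_)
  rw [contDiff_one_iff_deriv]
  exact ⟨fun x => (hf x).differentiableAt, by rwa [funext fun x => (hf x).deriv]⟩

theorem IsFundamental.ac_c {z : 𝕜} {c s : ℝ → 𝕜} (h : IsFundamental z c s) (a b : ℝ) :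
    AbsolutelyContinuousOnInterval c a b :=
  absolutelyContinuousOnInterval_of_hasDerivAt h.hc (continuous_const.mul h.continuous_s) a b

theorem IsFundamental.ac_s {z : 𝕜} {c s : ℝ → 𝕜} (h : IsFundamental z c s) (a b : ℝ) :
    AbsolutelyContinuousOnInterval s a b :=
  absolutelyContinuousOnInterval_of_hasDerivAt h.hs h.continuous_c a b

/-- Every solution of `u'' = -z u` is a combination of the fundamental solutions. -/
theorem IsFundamental.eq_of_solution {z : 𝕜} {c s : ℝ → 𝕜} (h : IsFundamental z c s) {l : ℝ}
    (hl : 0 < l) {u u' : ℝ → 𝕜} (hu : AbsolutelyContinuousOnInterval u 0 l)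
    (hd : ∀ x ∈ Icc 0 l, HasDerivWithinAt u (u' x) (Icc 0 l) x)
    (hu' : AbsolutelyContinuousOnInterval u' 0 l)
    (hd' : ∀ᵐ x ∂volume.restrict (Icc 0 l), HasDerivAt u' (-z * u x) x) {x : ℝ}
    (hx : x ∈ Icc 0 l) :
    u x = u 0 * c x + u' 0 * s x ∧ u' x = u 0 * (-z * s x) + u' 0 * c x := by
  have hI : ∀ᵐ x, x ∈ uIcc 0 l → HasDerivAt u (u' x) x ∧ HasDerivAt u' (-z * u x) x := by
    rw [uIcc_of_le hl.le, ← ae_restrict_iff' measurableSet_Icc]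
    filter_upwards [ae_mem_Ioo l, hd'] with y h1 h2
    exact ⟨(hd y (Ioo_subset_Icc_self h1)).hasDerivAt (Icc_mem_nhds h1.1 h1.2), h2⟩
  -- Two first integrals, constant because their derivatives vanish almost everywhere. They are
  -- linear in `(u, u')` with determinant the Wronskian `1`, so they can be solved for `u` and `u'`.
  have e1 : u x * c x - u' x * s x = u 0 := by
    obtain ⟨C, hC⟩ := ((hu.smul (h.ac_c 0 l)).sub
      (hu'.smul (h.ac_s 0 l))).const_of_ae_hasDerivAt_zero (by
        filter_upwards [hI] with y hy hy'
        obtain ⟨h1, h2⟩ := hy hy'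
        refine ((h1.mul (h.hc y)).sub (h2.mul (h.hs y))).congr_deriv ?_
        ring)
    have e1 := hC x (by rwa [uIcc_of_le hl.le])
    have e0 := hC 0 left_mem_uIcc
    simp only [Pi.sub_apply, Pi.mul_apply, smul_eq_mul, h.c0, h.s0, mul_one, mul_zero,
      sub_zero] at e1 e0
    rw [e1, e0]
  have e2 : u x * (z * s x) + u' x * c x = u' 0 := by
    obtain ⟨C, hC⟩ := ((hu.smul ((h.ac_s 0 l).const_smul z)).add
      (hu'.smul (h.ac_c 0 l))).const_of_ae_hasDerivAt_zero (by
        filter_upwards [hI] with y hy hy'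
        obtain ⟨h1, h2⟩ := hy hy'
        refine ((h1.mul ((h.hs y).const_mul z)).add (h2.mul (h.hc y))).congr_deriv ?_
        ring)
    have e1 := hC x (by rwa [uIcc_of_le hl.le])
    have e0 := hC 0 left_mem_uIcc
    simp only [Pi.add_apply, Pi.mul_apply, smul_eq_mul, h.c0, h.s0, mul_one, mul_zero,
      zero_add] at e1 e0
    rw [e1, e0]
  have hw := h.wronskian x
  constructor
  · linear_combination c x * e1 + s x * e2 - u x * hw
  · linear_combination -z * s x * e1 + c x * e2 - u' x * hw

/-- Variation of constants: `-u'' - z u = g` has a solution for every integrable `g`. -/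
theorem exists_solution (z : 𝕜) {l : ℝ} (hl : 0 < l) {g : ℝ → 𝕜}
    (hg : IntervalIntegrable g volume 0 l) :
    ∃ u u' : ℝ → 𝕜, AbsolutelyContinuousOnInterval u 0 l ∧
      (∀ x ∈ Icc 0 l, HasDerivWithinAt u (u' x) (Icc 0 l) x) ∧
      AbsolutelyContinuousOnInterval u' 0 l ∧
      ∀ᵐ x ∂volume.restrict (Icc 0 l), HasDerivAt u' (-(g x + z * u x)) x := by
  obtain ⟨c, s, h⟩ := exists_isFundamental z
  have hsg : IntervalIntegrable (fun x => s x * g x) volume 0 l :=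
    hg.continuousOn_mul h.continuous_s.continuousOn
  have hcg : IntervalIntegrable (fun x => c x * g x) volume 0 l :=
    hg.continuousOn_mul h.continuous_c.continuousOn
  set A : ℝ → 𝕜 := fun x => ∫ t in (0 : ℝ)..x, s t * g t
  set B : ℝ → 𝕜 := fun x => ∫ t in (0 : ℝ)..x, c t * g t
  have hA : AbsolutelyContinuousOnInterval A 0 l := absolutelyContinuousOnInterval_primitive hsg
  have hB : AbsolutelyContinuousOnInterval B 0 l := absolutelyContinuousOnInterval_primitive hcg
  have hAB : ∀ᵐ x ∂volume.restrict (Icc 0 l),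
      HasDerivAt A (s x * g x) x ∧ HasDerivAt B (c x * g x) x := by
    rw [ae_restrict_iff' measurableSet_Icc]
    filter_upwards [hsg.ae_hasDerivAt_integral, hcg.ae_hasDerivAt_integral] with x h1 h2 hx
    rw [← uIcc_of_le hl.le] at hx
    exact ⟨h1 hx 0 left_mem_uIcc, h2 hx 0 left_mem_uIcc⟩
  set u : ℝ → 𝕜 := fun x => c x * A x - s x * B x
  set u' : ℝ → 𝕜 := fun x => -z * s x * A x - c x * B x
  have hu : AbsolutelyContinuousOnInterval u 0 l :=
    ((h.ac_c 0 l).smul hA).sub ((h.ac_s 0 l).smul hB)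
  have hu' : AbsolutelyContinuousOnInterval u' 0 l :=
    (((h.ac_s 0 l).const_smul (-z)).smul hA).sub ((h.ac_c 0 l).smul hB)
  have hc' : ContinuousOn u' (Icc 0 l) := by simpa [uIcc_of_le hl.le] using hu'.continuousOn
  have hint : ∀ x ∈ Icc 0 l, ∫ t in (0 : ℝ)..x, u' t = u x - u 0 := fun x hx => by
    refine integral_eq_sub_of_ae_hasDerivAt hl hu ?_ ?_ hx
    · exact ContinuousOn.intervalIntegrable (by rwa [uIcc_of_le hl.le])
    · filter_upwards [hAB] with y ⟨h1, h2⟩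
      refine (((h.hc y).mul h1).sub ((h.hs y).mul h2)).congr_deriv ?_
      simp only [u']; ring
  refine ⟨u, u', hu, fun x hx => ?_, hu', ?_⟩
  -- The product rule gives the derivative of `u` only almost everywhere; as `u` is, up to a
  -- constant, the integral of the continuous `u'`, it holds at every point, endpoints included.
  · have : HasDerivWithinAt (fun x => ∫ t in (0 : ℝ)..x, u' t) (u' x) (Icc 0 l) x := by
      have : Fact (x ∈ Icc 0 l) := ⟨hx⟩
      refine intervalIntegral.integral_hasDerivWithinAt_right ?_ ?_ (hc' x hx)
      · refine ContinuousOn.intervalIntegrable (hc'.mono ?_)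
        rw [uIcc_of_le hx.1]
        exact Icc_subset_Icc_right hx.2
      · exact hc'.stronglyMeasurableAtFilter_nhdsWithin measurableSet_Icc x
    refine (this.add_const (u 0)).congr (fun y hy => ?_) ?_
    · rw [hint y hy]; ring
    · rw [hint x hx]; ring
  · filter_upwards [hAB] with y ⟨h1, h2⟩
    refine ((((h.hs y).const_mul (-z)).mul h1).sub ((h.hc y).mul h2)).congr_deriv ?_
    simp only [u]
    linear_combination -g y * h.wronskian y

/-- Integration by parts against the second derivative. -/
theorem integral_inner_second_deriv {l : ℝ} (hl : 0 < l) {u' w w' g : ℝ → 𝕜}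
    (hg : IntervalIntegrable g volume 0 l)
    (hu' : AbsolutelyContinuousOnInterval u' 0 l)
    (hd' : ∀ᵐ x ∂volume.restrict (Icc 0 l), HasDerivAt u' (-g x) x)
    (hw : AbsolutelyContinuousOnInterval w 0 l)
    (hwd : ∀ x ∈ Icc 0 l, HasDerivWithinAt w (w' x) (Icc 0 l) x)
    (hw' : AbsolutelyContinuousOnInterval w' 0 l) :
    ∫ x in Icc 0 l, inner 𝕜 (g x) (w x) =
      (∫ x in Icc 0 l, inner 𝕜 (u' x) (w' x)) - inner 𝕜 (u' l) (w l) + inner 𝕜 (u' 0) (w 0) := by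
  have hiso : Isometry (fun a : 𝕜 => (starRingEnd 𝕜) a) :=
    RCLike.conjLIE.isometry
  have hac := (hu'.comp_isometry hiso).smul hw
  have hgc : IntervalIntegrable (fun x => (starRingEnd 𝕜) (g x)) volume 0 l :=
    ⟨(RCLike.conjCLE (K := 𝕜)).toContinuousLinearMap.integrable_comp hg.1,
      (RCLike.conjCLE (K := 𝕜)).toContinuousLinearMap.integrable_comp hg.2⟩
  have hcont : ∀ {v : ℝ → 𝕜}, AbsolutelyContinuousOnInterval v 0 l → ContinuousOn v (uIcc 0 l) :=
    fun h => h.continuousOn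
  have i1 : IntervalIntegrable (fun x => (starRingEnd 𝕜) (u' x) * w' x) volume 0 l :=
    ((hcont (hu'.comp_isometry hiso)).mul (hcont hw')).intervalIntegrable
  have i2 : IntervalIntegrable (fun x => (starRingEnd 𝕜) (g x) * w x) volume 0 l :=
    hgc.mul_continuousOn (hcont hw)
  have := integral_eq_sub_of_ae_hasDerivAt hl hac (i1.sub i2) (by
    filter_upwards [ae_mem_Ioo l, hd'] with y h1 h2
    have h3 := (hwd y (Ioo_subset_Icc_self h1)).hasDerivAt (Icc_mem_nhds h1.1 h1.2)
    have h4 : HasDerivAt (fun x => (starRingEnd 𝕜) (u' x)) ((starRingEnd 𝕜) (-g y)) y :=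
      (RCLike.conjCLE (K := 𝕜)).hasFDerivAt.comp_hasDerivAt y h2
    refine (h4.mul h3).congr_deriv ?_
    simp only [map_neg]; ring) (right_mem_Icc.2 hl.le)
  rw [intervalIntegral.integral_sub i1 i2, intervalIntegral.integral_of_le hl.le,
    intervalIntegral.integral_of_le hl.le, ← integral_Icc_eq_integral_Ioc,
    ← integral_Icc_eq_integral_Ioc] at this
  simp only [Pi.smul_apply', smul_eq_mul] at this
  simp only [RCLike.inner_apply']
  linear_combination -this

end Interval

/-! ### Resolvents of symmetric operators -/

section Symmetric

variable {𝕜 H : Type*} [RCLike 𝕜] [NormedAddCommGroup H] [InnerProductSpace 𝕜 H]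

/-- For a symmetric operator `T`, bijectivity of `T - z` suffices for `z` to be in the resolvent
set: the inverse is automatically bounded. -/
theorem notMem_spectrumOf_of_bijective [CompleteSpace H] {T : H →ₗ.[𝕜] H}
    (hT : ∀ f g : T.domain, inner 𝕜 (T f) (g : H) = inner 𝕜 (f : H) (T g)) {z : 𝕜}
    (hinj : eigenspaceOf T z = ⊥) (hsurj : ∀ g : H, ∃ f : T.domain, T f - z • (f : H) = g) :
    z ∉ spectrumOf T := by
  let L : T.domain →ₗ[𝕜] H := T.toFun - z • T.domain.subtype
  have hL : ∀ f, L f = T f - z • (f : H) := fun f => rfl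
  let e : T.domain ≃ₗ[𝕜] H := LinearEquiv.ofBijective L
    ⟨LinearMap.ker_eq_bot.1 hinj, hsurj⟩
  let R : H →ₗ[𝕜] H := T.domain.subtype ∘ₗ e.symm.toLinearMap
  have hR : ∀ g, T (e.symm g) - z • (e.symm g : H) = g := fun g => e.apply_symm_apply g
  have hRc : Continuous R := by
    -- For real `z` the inverse is symmetric and everywhere defined, hence continuous by
    -- Hellinger–Toeplitz. For non-real `z` symmetry yields the bound `2 / ‖z - z̄‖` directly.
    by_cases hz : (starRingEnd 𝕜) z = z
    · refine LinearMap.IsSymmetric.continuous fun g k => ?_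
      change inner 𝕜 (e.symm g : H) k = inner 𝕜 g (e.symm k : H)
      have h := hT (e.symm g) (e.symm k)
      conv_lhs => rw [← hR k]
      conv_rhs => rw [← hR g]
      rw [inner_sub_left, inner_sub_right, h, inner_smul_left, inner_smul_right, hz]
    · have hd : 0 < ‖z - (starRingEnd 𝕜) z‖ := norm_pos_iff.2 (sub_ne_zero.2 (Ne.symm hz))
      refine AddMonoidHomClass.continuous_of_bound R (2 / ‖z - (starRingEnd 𝕜) z‖) fun g => ?_
      change ‖(e.symm g : H)‖ ≤ _
      set f := e.symm g
      have h1 : (z - (starRingEnd 𝕜) z) * inner 𝕜 (f : H) (f : H)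
          = inner 𝕜 g (f : H) - inner 𝕜 (f : H) g := by
        rw [← hR g, inner_sub_left, inner_sub_right, inner_smul_left, inner_smul_right, hT f f]
        ring
      have h2 : ‖z - (starRingEnd 𝕜) z‖ * (‖(f : H)‖ * ‖(f : H)‖) ≤ 2 * ‖g‖ * ‖(f : H)‖ := by
        have := congrArg norm h1
        rw [norm_mul, ← inner_self_re_eq_norm, inner_self_eq_norm_mul_norm] at this
        calc _ = _ := this
          _ ≤ _ := norm_sub_le _ _
          _ ≤ ‖g‖ * ‖(f : H)‖ + ‖(f : H)‖ * ‖g‖ :=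
            add_le_add (norm_inner_le_norm _ _) (norm_inner_le_norm _ _)
          _ = _ := by ring
      rcases (norm_nonneg (f : H)).eq_or_lt with h0 | h0
      · rw [← h0]; positivity
      · rw [div_mul_eq_mul_div, le_div_iff₀ hd]
        nlinarith
  refine fun hz => hz ⟨⟨R, hRc⟩, fun g => ⟨(e.symm g).2, hR g⟩, fun f => ?_⟩
  exact congrArg Subtype.val (e.symm_apply_apply f)

theorem mem_spectrumOf_of_eigenspaceOf_ne_bot {T : H →ₗ.[𝕜] H} {z : 𝕜}
    (h : eigenspaceOf T z ≠ ⊥) : z ∈ spectrumOf T := by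
  rintro ⟨R, -, hR⟩
  refine h ((Submodule.eq_bot_iff _).2 fun f hf => ?_)
  have h0 : T f - z • (f : H) = 0 := hf
  have := hR f
  rw [h0, map_zero] at this
  exact Subtype.ext this.symm

end Symmetric

/-! ### Vertex conditions, symmetry and the quadratic form -/

namespace MetricGraph

variable {V E : Type*} (Γ : MetricGraph V E) {𝕜 : Type*} [RCLike 𝕜] [Fintype E]

open Classical in
/-- The sum over the edge ends at each vertex, for given values at the starting and at the ending
points of the edges. -/
def vertexSum : (E → 𝕜) × (E → 𝕜) →ₗ[𝕜] V → 𝕜 where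
  toFun p v := ∑ e, ((if Γ.o e = v then p.1 e else 0) + if Γ.t e = v then p.2 e else 0)
  map_add' p q := by
    ext v
    simp only [Prod.fst_add, Prod.snd_add, Pi.add_apply, ← Finset.sum_add_distrib]
    refine Finset.sum_congr rfl fun e _ => ?_
    split_ifs <;> ring
  map_smul' r p := by
    ext v
    simp only [Prod.smul_fst, Prod.smul_snd, Pi.smul_apply, smul_eq_mul, RingHom.id_apply,
      Finset.mul_sum]
    refine Finset.sum_congr rfl fun e _ => ?_
    split_ifs <;> ring

theorem sum_valueAt (u : E → ℝ → 𝕜) (v : V) :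
    ∑ e, Γ.valueAt u v e = Γ.vertexSum (fun e => u e 0, fun e => u e (Γ.length e)) v := by
  refine Finset.sum_congr rfl fun e _ => ?_
  unfold valueAt
  have := Γ.loopless e
  split_ifs with h1 h2 <;> simp
  exact absurd (h1.trans h2.symm) this

/-- Summation by parts on the graph: each edge end is counted at exactly one vertex. All the energy
arguments below pair a vertex condition with a conjugated vertex function in this way. -/
theorem sum_mul_vertexSum [Fintype V] (ψ : V → 𝕜) (p : (E → 𝕜) × (E → 𝕜)) :
    ∑ v, ψ v * Γ.vertexSum p v = ∑ e, (ψ (Γ.o e) * p.1 e + ψ (Γ.t e) * p.2 e) := by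
  classical
  simp only [vertexSum, LinearMap.coe_mk, AddHom.coe_mk, Finset.mul_sum]
  rw [Finset.sum_comm]
  refine Finset.sum_congr rfl fun e _ => ?_
  simp [mul_add, Finset.sum_add_distrib]

theorem antiStandard_iff {u u' : E → ℝ → 𝕜} :
    Γ.AntiStandard u u' ↔ ∃ φ : V → 𝕜, (∀ e, u' e 0 = φ (Γ.o e)) ∧
      (∀ e, u' e (Γ.length e) = -φ (Γ.t e)) ∧
      Γ.vertexSum (fun e => u e 0, fun e => u e (Γ.length e)) = 0 := by
  classical
  have ho : ∀ e, Γ.outDerivAt u' (Γ.o e) e = u' e 0 := fun e => by simp [outDerivAt]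
  have ht : ∀ e, Γ.outDerivAt u' (Γ.t e) e = -u' e (Γ.length e) := fun e => by
    simp [outDerivAt, Γ.loopless e]
  constructor
  · intro h
    -- The common outgoing derivative at `v`; the default `0` is harmless, since a vertex without
    -- edges imposes no condition on `φ`.
    let φ : V → 𝕜 := fun v => if hv : ∃ e, Γ.o e = v ∨ Γ.t e = v then
      Γ.outDerivAt u' v hv.choose else 0
    have hφ : ∀ v e, (Γ.o e = v ∨ Γ.t e = v) → φ v = Γ.outDerivAt u' v e := fun v e he => by
      have hv : ∃ e, Γ.o e = v ∨ Γ.t e = v := ⟨e, he⟩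
      simp only [φ, dif_pos hv]
      exact h.deriv_eq v _ _ hv.choose_spec he
    refine ⟨φ, fun e => ?_, fun e => ?_, ?_⟩
    · rw [hφ _ e (.inl rfl), ho]
    · rw [hφ _ e (.inr rfl), ht, neg_neg]
    · ext v
      rw [← sum_valueAt, h.sum_eq_zero, Pi.zero_apply]
  · rintro ⟨φ, h0, h1, h2⟩
    have key : ∀ v e, (Γ.o e = v ∨ Γ.t e = v) → Γ.outDerivAt u' v e = φ v := by
      rintro v e (rfl | rfl)
      · rw [ho, h0]
      · rw [ht, h1, neg_neg]
    exact ⟨fun v e e' he he' => (key v e he).trans (key v e' he').symm,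
      fun v => by rw [sum_valueAt, h2, Pi.zero_apply]⟩

/-- The quadratic form of the anti-standard Laplacian. -/
theorem inner_eq_sum_integral [Fintype V] {f g f₁ g₁ : Γ.L2 𝕜} {u u' w w' : E → ℝ → 𝕜}
    (h : Γ.IsMaxLaplacian f g u u') (a : Γ.AntiStandard u u')
    (k : Γ.IsMaxLaplacian f₁ g₁ w w') (b : Γ.AntiStandard w w') :
    inner 𝕜 g f₁ = ∑ e, ∫ x in Icc 0 (Γ.length e), inner 𝕜 (u' e x) (w' e x) := by
  obtain ⟨φ, h0, h1, -⟩ := Γ.antiStandard_iff.1 a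
  obtain ⟨-, -, -, h2⟩ := Γ.antiStandard_iff.1 b
  have hE : ∀ e, inner 𝕜 (g e) (f₁ e) = (∫ x in Icc 0 (Γ.length e), inner 𝕜 (u' e x) (w' e x))
      + ((starRingEnd 𝕜) (φ (Γ.o e)) * w e 0
        + (starRingEnd 𝕜) (φ (Γ.t e)) * w e (Γ.length e)) := fun e => by
    have hl := Γ.length_pos e
    rw [L2.inner_def]
    have := integral_inner_second_deriv hl (intervalIntegrable_of_L2 hl (g e)) (h.ac_deriv e)
      (h.hasDeriv_deriv e) (k.ac e) (k.hasDeriv e) (k.ac_deriv e)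
    rw [integral_congr_ae (g := fun x => inner 𝕜 ((g e : ℝ → 𝕜) x) (w e x)) (by
      filter_upwards [k.ae_eq e] with x hx
      rw [hx]), this, h0, h1]
    simp only [RCLike.inner_apply', map_neg]
    ring
  -- The boundary terms regroup by vertices: the derivative factor is constant at each vertex, and
  -- the values of `w` there sum to zero.
  rw [PiLp.inner_apply, Finset.sum_congr rfl fun e _ => hE e, Finset.sum_add_distrib,
    ← Γ.sum_mul_vertexSum (fun v => (starRingEnd 𝕜) (φ v))
      (fun e => w e 0, fun e => w e (Γ.length e)), h2]
  simp

theorem mem_graph_iff {f g : Γ.L2 𝕜} :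
    (∃ h : f ∈ (Γ.antiStandardLaplacian 𝕜).domain, Γ.antiStandardLaplacian 𝕜 ⟨f, h⟩ = g) ↔
      ∃ u u' : E → ℝ → 𝕜, Γ.IsMaxLaplacian f g u u' ∧ Γ.AntiStandard u u' := by
  have : (f, g) ∈ (Γ.antiStandardLaplacian 𝕜).graph ↔ (f, g) ∈ Γ.antiStandardGraph 𝕜 := by
    rw [antiStandardLaplacian_graph]
  rw [LinearPMap.mem_graph_iff] at this
  refine Iff.trans ⟨?_, ?_⟩ this
  · rintro ⟨h, e⟩; exact ⟨⟨f, h⟩, rfl, e⟩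
  · rintro ⟨⟨y, hy⟩, rfl, e⟩; exact ⟨hy, e⟩

theorem antiStandardLaplacian_symmetric [Fintype V]
    (f g : (Γ.antiStandardLaplacian 𝕜).domain) :
    inner 𝕜 (Γ.antiStandardLaplacian 𝕜 f) (g : Γ.L2 𝕜)
      = inner 𝕜 (f : Γ.L2 𝕜) (Γ.antiStandardLaplacian 𝕜 g) := by
  obtain ⟨u, u', h, a⟩ := Γ.mem_graph_iff.1 ⟨f.2, rfl⟩
  obtain ⟨w, w', k, b⟩ := Γ.mem_graph_iff.1 ⟨g.2, rfl⟩
  rw [← inner_conj_symm (f : Γ.L2 𝕜)]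
  refine (Γ.inner_eq_sum_integral h a k b).trans (Eq.symm ?_)
  refine (congrArg (starRingEnd 𝕜) (Γ.inner_eq_sum_integral k b h a)).trans ?_
  rw [map_sum]
  refine Finset.sum_congr rfl fun e _ => ?_
  rw [← integral_conj]
  simp only [inner_conj_symm]

theorem mem_eigenspaceOf_iff {z : 𝕜} {f : (Γ.antiStandardLaplacian 𝕜).domain} :
    f ∈ eigenspaceOf (Γ.antiStandardLaplacian 𝕜) z ↔
      Γ.antiStandardLaplacian 𝕜 f = z • (f : Γ.L2 𝕜) :=
  sub_eq_zero

/-- The eigenvalues of the anti-standard Laplacian are real and nonnegative. -/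
theorem eigenvalue_nonneg [Fintype V] {z : 𝕜}
    (hz : eigenspaceOf (Γ.antiStandardLaplacian 𝕜) z ≠ ⊥) : ∃ μ : ℝ, 0 ≤ μ ∧ z = (μ : 𝕜) := by
  obtain ⟨f, hf, hf0⟩ := Submodule.exists_mem_ne_zero_of_ne_bot hz
  rw [mem_eigenspaceOf_iff] at hf
  obtain ⟨u, u', h, a⟩ := Γ.mem_graph_iff.1 ⟨f.2, hf⟩
  have key := Γ.inner_eq_sum_integral h a h a
  set r : ℝ := ∑ e, ∫ x in Icc 0 (Γ.length e), ‖u' e x‖ ^ 2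
  have hr : 0 ≤ r := Finset.sum_nonneg fun e _ => integral_nonneg fun x => by positivity
  have hsum : ∑ e, ∫ x in Icc 0 (Γ.length e), inner 𝕜 (u' e x) (u' e x) = (r : 𝕜) := by
    rw [RCLike.ofReal_sum]
    refine Finset.sum_congr rfl fun e _ => ?_
    rw [← integral_ofReal]
    simp only [inner_self_eq_norm_sq_to_K, RCLike.ofReal_pow]
  have hn : 0 < ‖(f : Γ.L2 𝕜)‖ := norm_pos_iff.2 fun h => hf0 (Subtype.ext h)
  rw [hsum, inner_smul_left, inner_self_eq_norm_sq_to_K] at key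
  refine ⟨r / ‖(f : Γ.L2 𝕜)‖ ^ 2, by positivity, ?_⟩
  have := congrArg (starRingEnd 𝕜) key
  rw [map_mul, RCLike.conj_conj, map_pow, RCLike.conj_ofReal, RCLike.conj_ofReal] at this
  rw [RCLike.ofReal_div, RCLike.ofReal_pow, ← this]
  have : ((‖(f : Γ.L2 𝕜)‖ : ℝ) : 𝕜) ≠ 0 := RCLike.ofReal_ne_zero.2 hn.ne'
  field_simp

end MetricGraph

/-! ### Reduction to a finite linear system -/

namespace MetricGraph

variable {V E : Type*} (Γ : MetricGraph V E) {𝕜 : Type*} [RCLike 𝕜] [Fintype E]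

/-- The defect in the anti-standard conditions of the solution `a c + b s` of `u'' = -z u` with
derivative data `φ` at the vertices. -/
def boundaryMap (z : 𝕜) (c s : ℝ → 𝕜) :
    (E → 𝕜) × (E → 𝕜) × (V → 𝕜) →ₗ[𝕜] (E → 𝕜) × (E → 𝕜) × (V → 𝕜) where
  toFun p := (fun e => p.2.1 e - p.2.2 (Γ.o e),
    fun e => p.1 e * (-z * s (Γ.length e)) + p.2.1 e * c (Γ.length e) + p.2.2 (Γ.t e),
    Γ.vertexSum (p.1, fun e => p.1 e * c (Γ.length e) + p.2.1 e * s (Γ.length e)))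
  map_add' p q := by
    refine Prod.ext ?_ (Prod.ext ?_ ?_)
    · ext e
      simp only [Prod.fst_add, Prod.snd_add, Pi.add_apply]
      ring
    · ext e
      simp only [Prod.fst_add, Prod.snd_add, Pi.add_apply]
      ring
    · simp only [Prod.snd_add]
      rw [← map_add]
      congr 1
      refine Prod.ext rfl ?_
      ext e
      simp only [Prod.fst_add, Prod.snd_add, Pi.add_apply]
      ring
  map_smul' r p := by
    refine Prod.ext ?_ (Prod.ext ?_ ?_)
    · ext e
      simp only [Prod.smul_fst, Prod.smul_snd, Pi.smul_apply, smul_eq_mul, RingHom.id_apply]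
      ring
    · ext e
      simp only [Prod.smul_fst, Prod.smul_snd, Pi.smul_apply, smul_eq_mul, RingHom.id_apply]
      ring
    · simp only [RingHom.id_apply, Prod.smul_snd]
      rw [← map_smul]
      congr 1
      refine Prod.ext rfl ?_
      ext e
      simp only [Prod.smul_fst, Prod.smul_snd, Pi.smul_apply, smul_eq_mul]
      ring

theorem mem_ker_boundaryMap {z : 𝕜} {c s : ℝ → 𝕜} {p : (E → 𝕜) × (E → 𝕜) × (V → 𝕜)} :
    p ∈ LinearMap.ker (Γ.boundaryMap z c s) ↔ (∀ e, p.2.1 e = p.2.2 (Γ.o e)) ∧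
      (∀ e, p.1 e * (-z * s (Γ.length e)) + p.2.1 e * c (Γ.length e) = -p.2.2 (Γ.t e)) ∧
      Γ.vertexSum (p.1, fun e => p.1 e * c (Γ.length e) + p.2.1 e * s (Γ.length e)) = 0 := by
  simp only [LinearMap.mem_ker, boundaryMap, LinearMap.coe_mk, AddHom.coe_mk, Prod.mk_eq_zero,
    funext_iff, Pi.zero_apply, sub_eq_zero, add_eq_zero_iff_eq_neg]

variable {Γ}

/-- The element of `L²(Γ)` given by `a c + b s` on the edges. -/
def ofCoeffs {z : 𝕜} {c s : ℝ → 𝕜} (h : IsFundamental z c s) :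
    (E → 𝕜) × (E → 𝕜) →ₗ[𝕜] Γ.L2 𝕜 where
  toFun p := WithLp.toLp 2 fun e =>
    p.1 e • (memLp_of_continuousOn (l := Γ.length e) h.continuous_c.continuousOn).toLp c +
    p.2 e • (memLp_of_continuousOn (l := Γ.length e) h.continuous_s.continuousOn).toLp s
  map_add' p q := by
    refine PiLp.ext fun e => ?_
    simp only [Prod.fst_add, Prod.snd_add, Pi.add_apply, PiLp.add_apply, add_smul]
    abel
  map_smul' r p := by
    refine PiLp.ext fun e => ?_
    simp only [Prod.smul_fst, Prod.smul_snd, Pi.smul_apply, smul_eq_mul, RingHom.id_apply,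
      PiLp.smul_apply, mul_smul, smul_add]

theorem ofCoeffs_ae_eq {z : 𝕜} {c s : ℝ → 𝕜} (h : IsFundamental z c s)
    (p : (E → 𝕜) × (E → 𝕜)) (e : E) :
    (ofCoeffs (Γ := Γ) h p e : ℝ → 𝕜) =ᵐ[volume.restrict (Icc 0 (Γ.length e))]
      fun x => p.1 e * c x + p.2 e * s x := by
  have hc := memLp_of_continuousOn (l := Γ.length e) h.continuous_c.continuousOn
  have hs := memLp_of_continuousOn (l := Γ.length e) h.continuous_s.continuousOn
  change ((p.1 e • hc.toLp c + p.2 e • hs.toLp s : Lp 𝕜 2 _) : ℝ → 𝕜) =ᵐ[_] _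
  filter_upwards [Lp.coeFn_add (p.1 e • hc.toLp c) (p.2 e • hs.toLp s),
    Lp.coeFn_smul (p.1 e) (hc.toLp c), Lp.coeFn_smul (p.2 e) (hs.toLp s),
    hc.coeFn_toLp, hs.coeFn_toLp] with x h1 h2 h3 h4 h5
  rw [h1, Pi.add_apply, h2, h3, Pi.smul_apply, Pi.smul_apply, h4, h5, smul_eq_mul, smul_eq_mul]

theorem IsFundamental.comb {z : 𝕜} {c s : ℝ → 𝕜} (h : IsFundamental z c s) (a b : 𝕜) (x : ℝ) :
    HasDerivAt (fun x => a * c x + b * s x) (a * (-z * s x) + b * c x) x :=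
  ((h.hc x).const_mul a).add ((h.hs x).const_mul b)

theorem IsFundamental.comb' {z : 𝕜} {c s : ℝ → 𝕜} (h : IsFundamental z c s) (a b : 𝕜) (x : ℝ) :
    HasDerivAt (fun x => a * (-z * s x) + b * c x) (-(z * (a * c x + b * s x))) x :=
  ((((h.hs x).const_mul (-z)).const_mul a).add ((h.hc x).const_mul b)).congr_deriv (by ring)

theorem isMaxLaplacian_ofCoeffs {z : 𝕜} {c s : ℝ → 𝕜} (h : IsFundamental z c s)
    (p : (E → 𝕜) × (E → 𝕜)) :
    Γ.IsMaxLaplacian (ofCoeffs h p) (z • ofCoeffs h p) (fun e x => p.1 e * c x + p.2 e * s x)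
      (fun e x => p.1 e * (-z * s x) + p.2 e * c x) where
  ae_eq e := ofCoeffs_ae_eq h p e
  ac e := ((h.ac_c _ _).const_smul (p.1 e)).add ((h.ac_s _ _).const_smul (p.2 e))
  hasDeriv e x _ := (IsFundamental.comb h _ _ x).hasDerivWithinAt
  ac_deriv e := (((h.ac_s _ _).const_smul (-z)).const_smul (p.1 e)).add
    ((h.ac_c _ _).const_smul (p.2 e))
  hasDeriv_deriv e := by
    filter_upwards [ofCoeffs_ae_eq h p e, Lp.coeFn_smul z (ofCoeffs (Γ := Γ) h p e)] with x h1 h2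
    rw [PiLp.smul_apply, h2, Pi.smul_apply, h1, smul_eq_mul]
    exact IsFundamental.comb' h _ _ x

theorem IsMaxLaplacian.eq_comb {z : 𝕜} {c s : ℝ → 𝕜} (h : IsFundamental z c s)
    {f : Γ.L2 𝕜} {u u' : E → ℝ → 𝕜} (k : Γ.IsMaxLaplacian f (z • f) u u') (e : E) {x : ℝ}
    (hx : x ∈ Icc 0 (Γ.length e)) :
    u e x = u e 0 * c x + u' e 0 * s x ∧ u' e x = u e 0 * (-z * s x) + u' e 0 * c x := by
  refine h.eq_of_solution (Γ.length_pos e) (k.ac e) (k.hasDeriv e) (k.ac_deriv e) ?_ hx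
  filter_upwards [k.hasDeriv_deriv e, k.ae_eq e, Lp.coeFn_smul z (f e)] with y h1 h2 h3
  rw [PiLp.smul_apply, h3, Pi.smul_apply, h2, smul_eq_mul] at h1
  exact h1.congr_deriv (by ring)

/-- Continuous functions that agree almost everywhere on an interval agree on it. Hence the endpoint
data depend only on the `L²` class. -/
theorem IsMaxLaplacian.eqOn_of_eq {f g f₁ g₁ : Γ.L2 𝕜} {u u' w w' : E → ℝ → 𝕜}
    (h : Γ.IsMaxLaplacian f g u u') (k : Γ.IsMaxLaplacian f₁ g₁ w w') (hf : f = f₁) (e : E) :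
    EqOn (u e) (w e) (Icc 0 (Γ.length e)) ∧ EqOn (u' e) (w' e) (Icc 0 (Γ.length e)) := by
  subst hf
  have h1 : EqOn (u e) (w e) (Icc 0 (Γ.length e)) :=
    Measure.eqOn_Icc_of_ae_eq volume (Γ.length_pos e).ne ((h.ae_eq e).symm.trans (k.ae_eq e))
      (fun x hx => (h.hasDeriv e x hx).continuousWithinAt)
      (fun x hx => (k.hasDeriv e x hx).continuousWithinAt)
  refine ⟨h1, fun x hx => ?_⟩
  exact (uniqueDiffOn_Icc (Γ.length_pos e) x hx).eq_deriv _ (h.hasDeriv e x hx)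
    ((k.hasDeriv e x hx).congr h1 (h1 hx))

theorem ofCoeffs_injective {z : 𝕜} {c s : ℝ → 𝕜} (h : IsFundamental z c s) :
    Function.Injective (ofCoeffs (Γ := Γ) h) := by
  intro p q hpq
  have H := fun e => (isMaxLaplacian_ofCoeffs h p).eqOn_of_eq (isMaxLaplacian_ofCoeffs h q) hpq e
  have h0 : ∀ e, (0 : ℝ) ∈ Icc 0 (Γ.length e) := fun e => left_mem_Icc.2 (Γ.length_pos e).le
  refine Prod.ext (funext fun e => ?_) (funext fun e => ?_)
  · simpa [h.c0, h.s0] using (H e).1 (h0 e)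
  · simpa [h.c0, h.s0] using (H e).2 (h0 e)

theorem antiStandard_comb_iff {z : 𝕜} {c s : ℝ → 𝕜} (h : IsFundamental z c s)
    (a b : E → 𝕜) :
    Γ.AntiStandard (fun e x => a e * c x + b e * s x) (fun e x => a e * (-z * s x) + b e * c x) ↔
      ∃ φ : V → 𝕜, (a, b, φ) ∈ LinearMap.ker (Γ.boundaryMap z c s) := by
  rw [antiStandard_iff]
  simp only [mem_ker_boundaryMap, h.c0, h.s0, mul_one, mul_zero, add_zero, zero_add]

theorem mem_eigenspaceOf_iff_exists {z : 𝕜} {c s : ℝ → 𝕜} (h : IsFundamental z c s)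
    {f : Γ.L2 𝕜} :
    (∃ k : f ∈ (Γ.antiStandardLaplacian 𝕜).domain,
      (⟨f, k⟩ : (Γ.antiStandardLaplacian 𝕜).domain) ∈
        eigenspaceOf (Γ.antiStandardLaplacian 𝕜) z) ↔
      ∃ p ∈ LinearMap.ker (Γ.boundaryMap z c s), ofCoeffs h (p.1, p.2.1) = f := by
  simp only [mem_eigenspaceOf_iff]
  rw [mem_graph_iff]
  constructor
  · rintro ⟨u, u', k, a⟩
    have hu := fun e x hx => k.eq_comb h e (x := x) hx
    have h0 : ∀ e, (0 : ℝ) ∈ Icc 0 (Γ.length e) := fun e => left_mem_Icc.2 (Γ.length_pos e).le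
    have h1 : ∀ e, Γ.length e ∈ Icc 0 (Γ.length e) := fun e =>
      right_mem_Icc.2 (Γ.length_pos e).le
    obtain ⟨φ, p1, p2, p3⟩ := Γ.antiStandard_iff.1 a
    refine ⟨(fun e => u e 0, fun e => u' e 0, φ), Γ.mem_ker_boundaryMap.2 ⟨p1, fun e => ?_, ?_⟩,
      ?_⟩
    · rw [← p2, (hu e _ (h1 e)).2]
    · rw [← p3]
      congr 2
      ext e
      exact (hu e _ (h1 e)).1.symm
    · refine PiLp.ext fun e => Lp.ext ?_
      refine (ofCoeffs_ae_eq h _ e).trans (Filter.EventuallyEq.trans ?_ (k.ae_eq e).symm)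
      filter_upwards [ae_restrict_mem measurableSet_Icc] with x hx
      exact (hu e x hx).1.symm
  · rintro ⟨⟨a, b, φ⟩, hp, rfl⟩
    exact ⟨_, _, isMaxLaplacian_ofCoeffs h (a, b), (antiStandard_comb_iff h a b).2 ⟨φ, hp⟩⟩

omit [Fintype E] in
variable (Γ) in
theorem exists_incident [Nontrivial V] (v : V) : ∃ e, Γ.o e = v ∨ Γ.t e = v := by
  obtain ⟨w, hw⟩ := Γ.connected.preconnected.exists_adj_of_nontrivial v
  rw [skeleton, SimpleGraph.fromRel_adj] at hw
  obtain ⟨-, ⟨e, h1, h2⟩ | ⟨e, h1, h2⟩⟩ := hw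
  exacts [⟨e, .inl h1⟩, ⟨e, .inr h2⟩]

/-- The eigenspace of the anti-standard Laplacian is the kernel of the boundary map. -/
def eigenspaceEquiv [Nontrivial V] {z : 𝕜} {c s : ℝ → 𝕜} (h : IsFundamental z c s) :
    eigenspaceOf (Γ.antiStandardLaplacian 𝕜) z ≃ₗ[𝕜] LinearMap.ker (Γ.boundaryMap z c s) := by
  let i : eigenspaceOf (Γ.antiStandardLaplacian 𝕜) z →ₗ[𝕜] Γ.L2 𝕜 :=
    (Γ.antiStandardLaplacian 𝕜).domain.subtype ∘ₗ Submodule.subtype _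
  let j : LinearMap.ker (Γ.boundaryMap z c s) →ₗ[𝕜] Γ.L2 𝕜 :=
    ofCoeffs h ∘ₗ ((LinearMap.fst 𝕜 _ _).prod (LinearMap.fst 𝕜 _ _ ∘ₗ LinearMap.snd 𝕜 _ _)) ∘ₗ
      Submodule.subtype _
  have hi : Function.Injective i := Subtype.val_injective.comp Subtype.val_injective
  have hj : Function.Injective j := by
    rintro ⟨p, hp⟩ ⟨q, hq⟩ hpq
    have h1 : (p.1, p.2.1) = (q.1, q.2.1) := ofCoeffs_injective h hpq
    obtain ⟨h2, h3⟩ := Prod.mk.inj h1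
    rw [mem_ker_boundaryMap] at hp hq
    refine Subtype.ext (Prod.ext h2 (Prod.ext h3 (funext fun v => ?_)))
    change p.2.2 v = q.2.2 v
    -- Every vertex lies on an edge because there are at least two vertices and the graph is
    -- connected, so `φ` can be read off from `a` and `b`.
    obtain ⟨e, rfl | rfl⟩ := Γ.exists_incident v
    · rw [← hp.1, ← hq.1, h3]
    · rw [← neg_inj, ← hp.2.1, ← hq.2.1, h2, h3]
  have hij : LinearMap.range i = LinearMap.range j := by
    ext f
    have := mem_eigenspaceOf_iff_exists (Γ := Γ) h (f := f)
    simp only [LinearMap.mem_range]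
    refine Iff.trans ⟨?_, ?_⟩ (this.trans ⟨?_, ?_⟩)
    · rintro ⟨⟨⟨f, k⟩, k'⟩, rfl⟩; exact ⟨k, k'⟩
    · rintro ⟨k, k'⟩; exact ⟨⟨⟨f, k⟩, k'⟩, rfl⟩
    · rintro ⟨p, hp, e⟩; exact ⟨⟨p, hp⟩, e⟩
    · rintro ⟨⟨p, hp⟩, e⟩; exact ⟨p, hp, e⟩
  exact (LinearEquiv.ofInjective i hi).trans
    ((LinearEquiv.ofEq _ _ hij).trans (LinearEquiv.ofInjective j hj).symm)

/-- A Fredholm alternative: take any edgewise solution of the inhomogeneous equation and correct its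
vertex defect by a homogeneous one. The correction exists because `boundaryMap` is an injective
endomorphism of a finite-dimensional space. -/
theorem exists_sub_smul_eq [Fintype V] [Nontrivial V] {z : 𝕜}
    (hz : eigenspaceOf (Γ.antiStandardLaplacian 𝕜) z = ⊥) (g : Γ.L2 𝕜) :
    ∃ f : (Γ.antiStandardLaplacian 𝕜).domain,
      Γ.antiStandardLaplacian 𝕜 f - z • (f : Γ.L2 𝕜) = g := by
  obtain ⟨c, s, h⟩ := exists_isFundamental z
  choose u u' hu hd hu' hd' using fun e =>
    exists_solution z (Γ.length_pos e) (intervalIntegrable_of_L2 (Γ.length_pos e) (g e))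
  have hsub : Subsingleton (eigenspaceOf (Γ.antiStandardLaplacian 𝕜) z) :=
    (Submodule.subsingleton_iff_eq_bot).2 hz
  have hker : LinearMap.ker (Γ.boundaryMap z c s) = ⊥ :=
    (Submodule.subsingleton_iff_eq_bot).1 ((eigenspaceEquiv h).symm.toEquiv.subsingleton)
  have hsurj := LinearMap.surjective_of_injective (LinearMap.ker_eq_bot.1 hker)
  obtain ⟨⟨a, b, φ⟩, hp⟩ := hsurj (fun e => -u' e 0, fun e => -u' e (Γ.length e),
    -Γ.vertexSum (fun e => u e 0, fun e => u e (Γ.length e)))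
  have hmem : ∀ e, MemLp (u e) 2 (volume.restrict (Icc 0 (Γ.length e))) := fun e =>
    memLp_of_continuousOn fun x hx => (hd e x hx).continuousWithinAt
  let f₀ : Γ.L2 𝕜 := WithLp.toLp 2 fun e => (hmem e).toLp (u e)
  have hf₀ : Γ.IsMaxLaplacian f₀ (g + z • f₀) u u' :=
    { ae_eq := fun e => (hmem e).coeFn_toLp
      ac := hu
      hasDeriv := hd
      ac_deriv := hu'
      hasDeriv_deriv := fun e => by
        filter_upwards [hd' e, Lp.coeFn_add (g e) (z • f₀ e), Lp.coeFn_smul z (f₀ e),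
          (hmem e).coeFn_toLp] with x h1 h2 h3 h4
        have h4' : (f₀ e : ℝ → 𝕜) x = u e x := h4
        rw [PiLp.add_apply, PiLp.smul_apply, h2, Pi.add_apply, h3, Pi.smul_apply, h4', smul_eq_mul]
        exact h1 }
  have hf := hf₀.add (isMaxLaplacian_ofCoeffs h (a, b))
  simp only [boundaryMap, LinearMap.coe_mk, AddHom.coe_mk, Prod.mk.injEq, funext_iff] at hp
  obtain ⟨h1, h2, h3⟩ := hp
  have ha : Γ.AntiStandard (u + fun e x => a e * c x + b e * s x)
      (u' + fun e x => a e * (-z * s x) + b e * c x) := by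
    refine Γ.antiStandard_iff.2 ⟨φ, fun e => ?_, fun e => ?_, ?_⟩
    · simp only [Pi.add_apply, h.c0, h.s0]
      linear_combination h1 e
    · simp only [Pi.add_apply]
      linear_combination h2 e
    · simp only [Pi.add_apply, h.c0, h.s0, mul_one, mul_zero, add_zero]
      rw [← funext_iff, ← add_eq_zero_iff_eq_neg', ← map_add] at h3
      exact h3
  obtain ⟨k, hk⟩ := Γ.mem_graph_iff.2 ⟨_, _, hf, ha⟩
  refine ⟨⟨_, k⟩, ?_⟩
  rw [hk, smul_add]
  abel

theorem mem_spectrumOf_iff [Fintype V] [Nontrivial V] {z : 𝕜} :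
    z ∈ spectrumOf (Γ.antiStandardLaplacian 𝕜) ↔
      eigenspaceOf (Γ.antiStandardLaplacian 𝕜) z ≠ ⊥ := by
  refine ⟨fun hz h => ?_, mem_spectrumOf_of_eigenspaceOf_ne_bot⟩
  exact notMem_spectrumOf_of_bijective Γ.antiStandardLaplacian_symmetric h
    (exists_sub_smul_eq h) hz

end MetricGraph

namespace MetricGraph

variable {V E : Type*} (Γ : MetricGraph V E) {𝕜 : Type*} [RCLike 𝕜]

/-! ### Incidence kernels and bipartiteness -/

section Incidence

/-- The incidence operator, with weight `1` at the starting points and `σ` at the ending points. -/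
def incidence [Fintype E] (σ : 𝕜) : (E → 𝕜) →ₗ[𝕜] V → 𝕜 :=
  Γ.vertexSum ∘ₗ LinearMap.prod LinearMap.id (σ • LinearMap.id)

/-- The transpose of the incidence operator. -/
def coincidence (σ : 𝕜) : (V → 𝕜) →ₗ[𝕜] E → 𝕜 where
  toFun φ e := φ (Γ.o e) + σ * φ (Γ.t e)
  map_add' φ ψ := by ext e; simp only [Pi.add_apply]; ring
  map_smul' r φ := by ext e; simp only [Pi.smul_apply, smul_eq_mul, RingHom.id_apply]; ring

/-- Rank–nullity for the incidence matrix and for its transpose, which have the same rank. -/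
theorem finrank_ker_incidence [Fintype V] [Fintype E] (σ : 𝕜) :
    (Module.finrank 𝕜 (LinearMap.ker (Γ.incidence σ)) : ℤ) =
      Fintype.card E - Fintype.card V + Module.finrank 𝕜 (LinearMap.ker (Γ.coincidence σ)) := by
  classical
  let M : Matrix V E 𝕜 := fun v e => (if Γ.o e = v then 1 else 0) + if Γ.t e = v then σ else 0
  have h1 : M.mulVecLin = Γ.incidence σ := by
    refine LinearMap.ext fun a => funext fun v => ?_
    change ∑ e, M v e * a e = ∑ e, ((if Γ.o e = v then a e else 0) +
      if Γ.t e = v then σ * a e else 0)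
    refine Finset.sum_congr rfl fun e _ => ?_
    simp only [M]
    split_ifs <;> ring
  have h2 : M.transpose.mulVecLin = Γ.coincidence σ := by
    refine LinearMap.ext fun φ => funext fun e => ?_
    change ∑ v, M v e * φ v = φ (Γ.o e) + σ * φ (Γ.t e)
    simp [M, add_mul, Finset.sum_add_distrib]
  have h3 := LinearMap.finrank_range_add_finrank_ker M.mulVecLin
  have h4 := LinearMap.finrank_range_add_finrank_ker M.transpose.mulVecLin
  have h5 : Module.finrank 𝕜 (LinearMap.range M.transpose.mulVecLin) =
      Module.finrank 𝕜 (LinearMap.range M.mulVecLin) := M.rank_transpose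
  rw [h1, Module.finrank_fintype_fun_eq_card] at h3
  rw [h5, h1, h2, Module.finrank_fintype_fun_eq_card] at h4
  omega

variable {Γ}

theorem mem_ker_coincidence {σ : 𝕜} {φ : V → 𝕜} :
    φ ∈ LinearMap.ker (Γ.coincidence σ) ↔ ∀ e, φ (Γ.o e) + σ * φ (Γ.t e) = 0 := by
  simp only [LinearMap.mem_ker, coincidence, LinearMap.coe_mk, AddHom.coe_mk, funext_iff,
    Pi.zero_apply]

theorem graph_adj_iff {v w : V} : Γ.graph.Adj v w ↔ ∃ e, s(Γ.o e, Γ.t e) = s(v, w) := by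
  simp only [graph, skeleton, SimpleGraph.fromRel_adj, Sym2.eq_iff]
  constructor
  · rintro ⟨-, ⟨e, h⟩ | ⟨e, h⟩⟩
    exacts [⟨e, .inl h⟩, ⟨e, .inr h⟩]
  · rintro ⟨e, h⟩
    refine ⟨?_, h.imp (⟨e, ·⟩) (⟨e, ·⟩)⟩
    rintro rfl
    have := Γ.loopless e
    rcases h with ⟨h1, h2⟩ | ⟨h1, h2⟩ <;> exact this (h1.trans h2.symm)

theorem coincidence_adj {σ : 𝕜} (hσ : σ * σ = 1) {φ : V → 𝕜}
    (h : φ ∈ LinearMap.ker (Γ.coincidence σ)) {v w : V} (hvw : Γ.graph.Adj v w) :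
    φ w = -σ * φ v := by
  rw [mem_ker_coincidence] at h
  obtain ⟨e, he⟩ := graph_adj_iff.1 hvw
  have := h e
  rcases Sym2.eq_iff.1 he with ⟨rfl, rfl⟩ | ⟨rfl, rfl⟩
  · linear_combination σ * this - φ (Γ.t e) * hσ
  · linear_combination this

theorem forall_of_adj {P : V → Prop} (hP : ∀ v w, Γ.graph.Adj v w → P v → P w) {v : V} (hv : P v)
    (w : V) : P w := by
  obtain ⟨p⟩ := Γ.connected.preconnected v w
  change Γ.graph.Walk v w at p
  induction p with
  | nil => exact hv
  | cons h _ ih => exact ih (hP _ _ h hv)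

theorem coincidence_eq_zero {σ : 𝕜} (hσ : σ * σ = 1) {φ : V → 𝕜}
    (h : φ ∈ LinearMap.ker (Γ.coincidence σ)) {v : V} (hv : φ v = 0) : φ = 0 := by
  refine funext (forall_of_adj (Γ := Γ) (P := fun w => φ w = 0) (fun v w hvw hv => ?_) hv)
  rw [coincidence_adj hσ h hvw, hv, mul_zero]

/-- Along an edge `φ` is multiplied by `-σ`, so by connectedness its value at one vertex determines
it; the kernel is at most a line, and `χ` spans it. -/
theorem finrank_ker_coincidence_eq_one {σ : 𝕜} (hσ : σ * σ = 1) {χ : V → 𝕜}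
    (h : χ ∈ LinearMap.ker (Γ.coincidence σ)) {v : V} (hv : χ v ≠ 0) :
    Module.finrank 𝕜 (LinearMap.ker (Γ.coincidence σ)) = 1 := by
  refine (finrank_eq_one_iff_of_nonzero' (⟨χ, h⟩ : LinearMap.ker (Γ.coincidence σ)) ?_).2 ?_
  · intro h0
    exact hv (congrFun (congrArg Subtype.val h0) v)
  · rintro ⟨φ, hφ⟩
    refine ⟨φ v / χ v, Subtype.ext ?_⟩
    have := coincidence_eq_zero hσ (Submodule.sub_mem _ (Submodule.smul_mem _ (φ v / χ v) h) hφ)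
      (v := v) (by simp [hv])
    exact sub_eq_zero.1 this

theorem finrank_ker_coincidence_neg_one :
    Module.finrank 𝕜 (LinearMap.ker (Γ.coincidence (-1 : 𝕜))) = 1 := by
  obtain ⟨v⟩ := Γ.connected.nonempty
  refine finrank_ker_coincidence_eq_one (by ring) (χ := fun _ => 1) ?_ (v := v) one_ne_zero
  rw [mem_ker_coincidence]
  intro e; ring

theorem finrank_ker_coincidence_one_of_isBipartite (hb : Γ.graph.IsBipartite) :
    Module.finrank 𝕜 (LinearMap.ker (Γ.coincidence (1 : 𝕜))) = 1 := by
  obtain ⟨v⟩ := Γ.connected.nonempty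
  obtain ⟨C⟩ := hb
  refine finrank_ker_coincidence_eq_one (by ring)
    (χ := fun v => if C v = 0 then 1 else -1) ?_ (v := v) (by split_ifs <;> simp)
  rw [mem_ker_coincidence]
  intro e
  have : C (Γ.o e) ≠ C (Γ.t e) := C.valid (graph_adj_iff.2 ⟨e, rfl⟩)
  split_ifs with h1 h2 h2
  · exact absurd (h1.trans h2.symm) this
  · ring
  · ring
  · omega

/-- `φ` changes sign along each edge, so by connectedness it takes only the values `±φ v`. These
differ when `φ v ≠ 0`, and the sign is a proper 2-colouring. -/
theorem isBipartite_of_mem_ker_coincidence {φ : V → 𝕜}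
    (h : φ ∈ LinearMap.ker (Γ.coincidence (1 : 𝕜))) (h0 : φ ≠ 0) : Γ.graph.IsBipartite := by
  classical
  obtain ⟨v, hv⟩ := Function.ne_iff.1 h0
  rw [Pi.zero_apply] at hv
  have hadj := fun {v w : V} (hvw : Γ.graph.Adj v w) => coincidence_adj (one_mul 1) h hvw
  have hpm : ∀ w, φ w = φ v ∨ φ w = -φ v :=
    forall_of_adj (Γ := Γ) (P := fun w => φ w = φ v ∨ φ w = -φ v) (fun x y hxy hx => by
      rw [hadj hxy]
      rcases hx with hx | hx <;> simp [hx]) (.inl rfl)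
  have C : Γ.graph.Coloring Bool := SimpleGraph.Coloring.mk (fun w => decide (φ w = φ v)) (by
    intro x y hxy heq
    have h1 := hadj hxy
    have h2 : (φ x = φ v) ↔ (φ y = φ v) := by simpa using heq
    have hne : φ v ≠ -φ v := fun h => hv (self_eq_neg.1 h)
    rcases hpm x with hx | hx
    · have := h2.1 hx
      rw [h1, hx] at this
      exact hne (by linear_combination -this)
    · refine hne ((h2.2 ?_).symm.trans hx)
      rw [h1, hx]; ring)
  simpa using! C.colorable

theorem finrank_ker_coincidence_one_of_not_isBipartite (hb : ¬ Γ.graph.IsBipartite) :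
    Module.finrank 𝕜 (LinearMap.ker (Γ.coincidence (1 : 𝕜))) = 0 := by
  have : LinearMap.ker (Γ.coincidence (1 : 𝕜)) = ⊥ := (Submodule.eq_bot_iff _).2 fun φ h => by
    by_contra h0
    exact hb (isBipartite_of_mem_ker_coincidence h h0)
  rw [this, finrank_bot]

end Incidence

/-! ### The transition matrix -/

section Transition

variable [Fintype V] [Fintype E]

/-- Each edge carries the value at one end to the other. Simplicity of the graph ensures that an
adjacent pair is counted once. -/
theorem adjacency_mulVec (φ : V → 𝕜) :
    (Γ.adjacency 𝕜).mulVec φ = Γ.vertexSum (fun e => φ (Γ.t e), fun e => φ (Γ.o e)) := by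
  classical
  have hA : ∀ v w, Γ.adjacency 𝕜 v w = ∑ e, ((if Γ.o e = v then (if Γ.t e = w then 1 else 0) else 0)
      + if Γ.t e = v then (if Γ.o e = w then 1 else 0) else 0) := fun v w => by
    rw [adjacency, SimpleGraph.adjMatrix_apply]
    split_ifs with h
    · obtain ⟨e, he⟩ := graph_adj_iff.1 h
      rw [Finset.sum_eq_single_of_mem e (Finset.mem_univ e)]
      · have := Γ.loopless e
        rcases Sym2.eq_iff.1 he with ⟨rfl, rfl⟩ | ⟨rfl, rfl⟩
        · simp [this.symm]
        · simp [this]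
      · intro e' _ hne
        have h1 : s(Γ.o e', Γ.t e') ≠ s(v, w) := fun h => hne (Γ.simple _ _ (h.trans he.symm))
        rw [Ne, Sym2.eq_iff] at h1
        split_ifs <;> simp_all
    · refine (Finset.sum_eq_zero fun e _ => ?_).symm
      have h1 : s(Γ.o e, Γ.t e) ≠ s(v, w) := fun h' => h (graph_adj_iff.2 ⟨e, h'⟩)
      rw [Ne, Sym2.eq_iff] at h1
      split_ifs <;> simp_all
  ext v
  simp only [Matrix.mulVec, dotProduct, hA, Finset.sum_mul]
  rw [Finset.sum_comm]
  refine Finset.sum_congr rfl fun e _ => ?_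
  simp only [add_mul, Finset.sum_add_distrib]
  congr 1 <;> split_ifs <;> simp

/-- The vector of the vertex degrees. -/
abbrev degreeVec (𝕜 : Type*) [RCLike 𝕜] : V → 𝕜 := (Γ.adjacency 𝕜).mulVec 1

theorem degreeVec_mul (φ : V → 𝕜) :
    Γ.degreeVec 𝕜 * φ = Γ.vertexSum (fun e => φ (Γ.o e), fun e => φ (Γ.t e)) := by
  classical
  ext v
  rw [Pi.mul_apply, degreeVec, adjacency_mulVec]
  simp only [vertexSum, LinearMap.coe_mk, AddHom.coe_mk, Finset.sum_mul, Pi.one_apply]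
  refine Finset.sum_congr rfl fun e _ => ?_
  split_ifs <;> simp_all [add_mul]

omit [Fintype E] in
theorem degreeVec_ne_zero [Nontrivial V] (v : V) : Γ.degreeVec 𝕜 v ≠ 0 := by
  classical
  have h1 : Γ.degreeVec 𝕜 v = (Γ.graph.degree v : 𝕜) := by
    have := SimpleGraph.adjMatrix_mulVec_const_apply (G := Γ.graph) (a := (1 : 𝕜)) (v := v)
    rw [mul_one] at this
    rw [← this]
    simp only [degreeVec, adjacency]
    congr!
  rw [h1]
  exact Nat.cast_ne_zero.2 (Γ.connected.preconnected.degree_pos_of_nontrivial (G := Γ.graph) v).ne'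

omit [Fintype E] in
theorem degreeVec_mul_transition_mulVec [DecidableEq V] [Nontrivial V] (φ : V → 𝕜) :
    Γ.degreeVec 𝕜 * (Γ.transition 𝕜).mulVec φ = (Γ.adjacency 𝕜).mulVec φ := by
  have hdet : IsUnit (Matrix.diagonal (Γ.degreeVec 𝕜)).det := by
    rw [Matrix.det_diagonal, isUnit_iff_ne_zero]
    exact Finset.prod_ne_zero_iff.2 fun v _ => Γ.degreeVec_ne_zero v
  have h : Matrix.diagonal (Γ.degreeVec 𝕜) * Γ.transition 𝕜 = Γ.adjacency 𝕜 :=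
    Matrix.mul_nonsing_inv_cancel_left _ _ hdet
  conv_rhs => rw [← h, ← Matrix.mulVec_mulVec]
  ext v
  rw [Matrix.mulVec_diagonal, Pi.mul_apply]

/-- Multiplying by the nonzero degrees turns `Z + C` into `A + C D`, whose action is a sum over edge
ends. This is the form in which the vertex condition appears. -/
theorem mem_ker_transition_add_iff [DecidableEq V] [Nontrivial V] {C : 𝕜} {φ : V → 𝕜} :
    φ ∈ LinearMap.ker (Matrix.toLin' (Γ.transition 𝕜 + C • 1)) ↔
      Γ.vertexSum (fun e => φ (Γ.o e) * C + φ (Γ.t e), fun e => φ (Γ.t e) * C + φ (Γ.o e)) = 0 := by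
  have h1 : Γ.vertexSum (fun e => φ (Γ.o e) * C + φ (Γ.t e), fun e => φ (Γ.t e) * C + φ (Γ.o e)) =
      Γ.degreeVec 𝕜 * ((Γ.transition 𝕜 + C • 1).mulVec φ) := by
    rw [Matrix.add_mulVec, mul_add, degreeVec_mul_transition_mulVec, adjacency_mulVec,
      Matrix.smul_mulVec, Matrix.one_mulVec, mul_smul_comm, degreeVec_mul, ← map_smul, ← map_add]
    congr 1
    refine Prod.ext ?_ ?_
    · ext e
      simp only [Prod.fst_add, Prod.smul_fst, Pi.add_apply, Pi.smul_apply, smul_eq_mul]; ring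
    · ext e
      simp only [Prod.snd_add, Prod.smul_snd, Pi.add_apply, Pi.smul_apply, smul_eq_mul]; ring
  rw [h1, LinearMap.mem_ker, Matrix.toLin'_apply]
  simp only [funext_iff, Pi.mul_apply, Pi.zero_apply, mul_eq_zero, Γ.degreeVec_ne_zero, false_or]

omit [Fintype E] in
theorem neg_mem_spectrum_transition_iff [DecidableEq V] {C : 𝕜} :
    -C ∈ spectrum 𝕜 (Γ.transition 𝕜) ↔
      Module.finrank 𝕜 (LinearMap.ker (Matrix.toLin' (Γ.transition 𝕜 + C • 1))) ≠ 0 := by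
  have h : algebraMap 𝕜 (Matrix V V 𝕜) (-C) - Γ.transition 𝕜 = -(Γ.transition 𝕜 + C • 1) := by
    rw [Algebra.algebraMap_eq_smul_one, neg_smul]; abel
  rw [spectrum.mem_iff, h, IsUnit.neg_iff, Matrix.isUnit_iff_isUnit_det, isUnit_iff_ne_zero,
    not_not, ← Matrix.exists_mulVec_eq_zero_iff, Ne, Submodule.finrank_eq_zero,
    Submodule.eq_bot_iff]
  push Not
  simp only [LinearMap.mem_ker, Matrix.toLin'_apply]
  exact exists_congr fun v => and_comm

theorem one_mem_spectrum_transition [DecidableEq V] [Nontrivial V] :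
    (1 : 𝕜) ∈ spectrum 𝕜 (Γ.transition 𝕜) := by
  rw [← neg_neg (1 : 𝕜), neg_mem_spectrum_transition_iff, Ne, Submodule.finrank_eq_zero]
  intro h
  have h1 : (1 : V → 𝕜) ∈ LinearMap.ker (Matrix.toLin' (Γ.transition 𝕜 + (-1 : 𝕜) • 1)) := by
    rw [mem_ker_transition_add_iff, ← map_zero Γ.vertexSum]
    congr 1
    refine Prod.ext ?_ ?_ <;> ext e <;> simp
  rw [h, Submodule.mem_bot] at h1
  obtain ⟨v⟩ := Γ.connected.nonempty
  exact one_ne_zero (congrFun h1 v)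

/-- An eigenvector satisfies `(D + A) φ = 0`; pairing with its conjugate gives `∑ |φ (o e) + φ (t
e)|² = 0`, so `φ` changes sign along every edge. -/
theorem isBipartite_of_neg_one_mem_spectrum [DecidableEq V] [Nontrivial V]
    (h : (-1 : 𝕜) ∈ spectrum 𝕜 (Γ.transition 𝕜)) : Γ.graph.IsBipartite := by
  rw [neg_mem_spectrum_transition_iff, Ne, Submodule.finrank_eq_zero] at h
  obtain ⟨φ, hφ, h0⟩ := Submodule.exists_mem_ne_zero_of_ne_bot h
  rw [mem_ker_transition_add_iff] at hφ
  refine isBipartite_of_mem_ker_coincidence (mem_ker_coincidence.2 fun e => ?_) h0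
  have h1 := Γ.sum_mul_vertexSum (fun v => (starRingEnd 𝕜) (φ v))
    (fun e => φ (Γ.o e) * 1 + φ (Γ.t e), fun e => φ (Γ.t e) * 1 + φ (Γ.o e))
  rw [hφ] at h1
  have h2 : ((∑ e, ‖φ (Γ.o e) + φ (Γ.t e)‖ ^ 2 : ℝ) : 𝕜) = 0 := by
    rw [RCLike.ofReal_sum]
    refine Eq.trans (Finset.sum_congr rfl fun e _ => ?_) (h1.symm.trans (by simp))
    rw [RCLike.ofReal_pow, ← RCLike.conj_mul, map_add]
    ring
  have h3 := (Finset.sum_eq_zero_iff_of_nonneg fun e _ => by positivity).1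
    (RCLike.ofReal_eq_zero.1 h2) e (Finset.mem_univ e)
  rw [one_mul]
  simpa using h3

end Transition

/-! ### Kernels of the boundary map and multiplicities -/

section Eigenspaces

variable [Fintype E] {Γ}

/-- The kernel of the boundary map at `0`. -/
def kerBoundaryMapZeroEquiv [Fintype V] [Nontrivial V] :
    LinearMap.ker (Γ.boundaryMap (0 : 𝕜) (fun _ => 1) (fun x => (x : 𝕜))) ≃ₗ[𝕜]
      LinearMap.ker (Γ.incidence (1 : 𝕜)) := by
  have key : ∀ p ∈ LinearMap.ker (Γ.boundaryMap (0 : 𝕜) (fun _ => 1) (fun x => (x : 𝕜))),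
      p.2.1 = 0 ∧ p.2.2 = 0 ∧ Γ.incidence (1 : 𝕜) p.1 = 0 := by
    rintro ⟨a, b, φ⟩ hp
    rw [mem_ker_boundaryMap] at hp
    obtain ⟨h1, h2, h3⟩ := hp
    simp only [neg_zero, zero_mul, mul_zero, zero_add, mul_one] at h1 h2 h3
    -- Pair the sum condition with `φ`. Since `φ (o e) = b e` and `φ (t e) = -b e`, the terms with
    -- `a` cancel and `-∑ length e * |b e|² = 0` remains.
    have h4 := Γ.sum_mul_vertexSum (fun v => (starRingEnd 𝕜) (φ v))
      (a, fun e => a e + b e * ((Γ.length e : ℝ) : 𝕜))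
    rw [h3] at h4
    have h5 : ((∑ e, Γ.length e * ‖b e‖ ^ 2 : ℝ) : 𝕜) = 0 := by
      rw [RCLike.ofReal_sum]
      have h6 : ∑ e, -(((Γ.length e * ‖b e‖ ^ 2 : ℝ)) : 𝕜) = 0 := by
        refine Eq.trans (Finset.sum_congr rfl fun e _ => ?_) (h4.symm.trans (by simp))
        have h7 : φ (Γ.t e) = -b e := by rw [h2, neg_neg]
        rw [RCLike.ofReal_mul, RCLike.ofReal_pow, ← RCLike.conj_mul, h7, ← h1, map_neg]
        ring
      rwa [Finset.sum_neg_distrib, neg_eq_zero] at h6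
    have h8 : ∀ e, b e = 0 := fun e => by
      have := (Finset.sum_eq_zero_iff_of_nonneg fun e _ =>
        mul_nonneg (Γ.length_pos e).le (sq_nonneg _)).1
        (RCLike.ofReal_eq_zero.1 h5) e (Finset.mem_univ e)
      simpa [(Γ.length_pos e).ne'] using this
    refine ⟨funext h8, funext fun v => ?_, ?_⟩
    · obtain ⟨e, rfl | rfl⟩ := Γ.exists_incident v
      · exact (h1 e).symm.trans (h8 e)
      · exact neg_eq_zero.1 ((h2 e).symm.trans (h8 e))
    · rw [← h3]
      change Γ.vertexSum (a, (1 : 𝕜) • a) = _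
      congr 2
      ext e
      simp [h8 e]
  refine
    { toFun := fun p => ⟨p.1.1, LinearMap.mem_ker.2 (key p.1 p.2).2.2⟩
      map_add' := fun p q => rfl
      map_smul' := fun r p => rfl
      invFun := fun a => ⟨(a.1, 0, 0), ?_⟩
      left_inv := fun p => ?_
      right_inv := fun a => rfl }
  · rw [mem_ker_boundaryMap]
    refine ⟨fun e => rfl, fun e => by simp, ?_⟩
    refine Eq.trans ?_ (LinearMap.mem_ker.1 a.2)
    change _ = Γ.vertexSum (a.1, (1 : 𝕜) • a.1)
    congr 2
    ext e
    simp
  · exact Subtype.ext (Prod.ext rfl (Prod.ext (key p.1 p.2).1.symm (key p.1 p.2).2.1.symm))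

/-- The kernel of the boundary map when the sine vanishes at the ends of the edges. -/
def kerBoundaryMapEquivOfSinEqZero {z σ : 𝕜} {c s : ℝ → 𝕜} (hσ : σ * σ = 1)
    (hs : ∀ e, s (Γ.length e) = 0) (hc : ∀ e, c (Γ.length e) = σ) :
    LinearMap.ker (Γ.boundaryMap z c s) ≃ₗ[𝕜]
      LinearMap.ker (Γ.incidence σ) × LinearMap.ker (Γ.coincidence σ) := by
  have key : ∀ p, p ∈ LinearMap.ker (Γ.boundaryMap z c s) ↔ (∀ e, p.2.1 e = p.2.2 (Γ.o e)) ∧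
      p.1 ∈ LinearMap.ker (Γ.incidence σ) ∧ p.2.2 ∈ LinearMap.ker (Γ.coincidence σ) := by
    rintro ⟨a, b, φ⟩
    rw [mem_ker_boundaryMap, mem_ker_coincidence, LinearMap.mem_ker]
    simp only [hs, hc, mul_zero, zero_add, add_zero]
    refine and_congr_right fun h1 => ?_
    rw [and_comm]
    refine and_congr ?_ (forall_congr' fun e => ?_)
    · have : (fun e => a e * σ) = σ • a := by ext e; simp [mul_comm]
      rw [this]; rfl
    · rw [h1]
      constructor
      · intro h; linear_combination σ * h - φ (Γ.o e) * hσ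
      · intro h; linear_combination σ * h - φ (Γ.t e) * hσ
  exact
    { toFun := fun p => (⟨p.1.1, ((key p.1).1 p.2).2.1⟩, ⟨p.1.2.2, ((key p.1).1 p.2).2.2⟩)
      map_add' := fun p q => rfl
      map_smul' := fun r p => rfl
      invFun := fun q => ⟨(q.1.1, fun e => q.2.1 (Γ.o e), q.2.1),
        (key _).2 ⟨fun e => rfl, q.1.2, q.2.2⟩⟩
      left_inv := fun p => Subtype.ext
        (Prod.ext rfl (Prod.ext (funext fun e => (((key p.1).1 p.2).1 e).symm) rfl))
      right_inv := fun q => rfl }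

/-- The kernel of the boundary map when the sine does not vanish at the ends of the edges. -/
def kerBoundaryMapEquivOfSinNeZero [Fintype V] [DecidableEq V] [Nontrivial V] {z C S : 𝕜}
    {c s : ℝ → 𝕜} (hz : z ≠ 0) (hS : S ≠ 0) (hw : C * C + z * (S * S) = 1)
    (hs : ∀ e, s (Γ.length e) = S) (hc : ∀ e, c (Γ.length e) = C) :
    LinearMap.ker (Γ.boundaryMap z c s) ≃ₗ[𝕜]
      LinearMap.ker (Matrix.toLin' (Γ.transition 𝕜 + C • 1)) := by
  have hzS : z * S ≠ 0 := mul_ne_zero hz hS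
  have key : ∀ p, p ∈ LinearMap.ker (Γ.boundaryMap z c s) ↔ (∀ e, p.2.1 e = p.2.2 (Γ.o e)) ∧
      (∀ e, p.1 e = (p.2.2 (Γ.o e) * C + p.2.2 (Γ.t e)) / (z * S)) ∧
      p.2.2 ∈ LinearMap.ker (Matrix.toLin' (Γ.transition 𝕜 + C • 1)) := by
    rintro ⟨a, b, φ⟩
    rw [mem_ker_boundaryMap, mem_ker_transition_add_iff]
    simp only [hs, hc]
    refine and_congr_right fun h1 => ?_
    have h2 : (∀ e, a e * (-z * S) + b e * C = -φ (Γ.t e)) ↔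
        ∀ e, a e = (φ (Γ.o e) * C + φ (Γ.t e)) / (z * S) := by
      refine forall_congr' fun e => ?_
      rw [h1, eq_div_iff hzS]
      constructor
      · intro h; linear_combination -h
      · intro h; linear_combination -h
    rw [h2]
    refine and_congr_right fun h3 => ?_
    -- The Wronskian identity makes the value at the ending point the mirror image of the one at the
    -- starting point, with the roles of `o` and `t` exchanged.
    have h4 : (a, fun e => a e * C + b e * S) = (z * S)⁻¹ •
        ((fun e => φ (Γ.o e) * C + φ (Γ.t e), fun e => φ (Γ.t e) * C + φ (Γ.o e)) :
          (E → 𝕜) × (E → 𝕜)) := by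
      refine Prod.ext (funext fun e => ?_) (funext fun e => ?_)
      · simp only [h3, Prod.smul_fst, Pi.smul_apply, smul_eq_mul]
        field_simp
      · simp only [h3, h1, Prod.smul_snd, Pi.smul_apply, smul_eq_mul]
        field_simp
        linear_combination φ (Γ.o e) * hw
    rw [h4, map_smul, smul_eq_zero, inv_eq_zero, or_iff_right hzS]
  exact
    { toFun := fun p => ⟨p.1.2.2, ((key p.1).1 p.2).2.2⟩
      map_add' := fun p q => rfl
      map_smul' := fun r p => rfl
      invFun := fun φ => ⟨(fun e => (φ.1 (Γ.o e) * C + φ.1 (Γ.t e)) / (z * S),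
        fun e => φ.1 (Γ.o e), φ.1), (key _).2 ⟨fun e => rfl, fun e => rfl, φ.2⟩⟩
      left_inv := fun p => Subtype.ext
        (Prod.ext (funext fun e => (((key p.1).1 p.2).2.1 e).symm)
          (Prod.ext (funext fun e => (((key p.1).1 p.2).1 e).symm) rfl))
      right_inv := fun q => rfl }

theorem finiteDimensional_eigenspaceOf [Finite V] [Nontrivial V] (z : 𝕜) :
    FiniteDimensional 𝕜 (eigenspaceOf (Γ.antiStandardLaplacian 𝕜) z) := by
  obtain ⟨c, s, h⟩ := exists_isFundamental z
  exact (eigenspaceEquiv (Γ := Γ) h).symm.finiteDimensional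

variable [Fintype V] [Nontrivial V]

theorem finrank_eigenspaceOf_zero :
    Module.finrank 𝕜 (eigenspaceOf (Γ.antiStandardLaplacian 𝕜) 0) =
      Module.finrank 𝕜 (LinearMap.ker (Γ.incidence (1 : 𝕜))) :=
  ((eigenspaceEquiv isFundamental_zero).trans kerBoundaryMapZeroEquiv).finrank_eq

theorem finrank_eigenspaceOf_of_sin_ne_zero [DecidableEq V] {ℓ μ : ℝ} (hΓ : Γ.IsEquilateral ℓ)
    (hμ : 0 < μ) (hs : Real.sin (√μ * ℓ) ≠ 0) :
    Module.finrank 𝕜 (eigenspaceOf (Γ.antiStandardLaplacian 𝕜) (μ : 𝕜)) =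
      Module.finrank 𝕜 (LinearMap.ker (Matrix.toLin'
        (Γ.transition 𝕜 + ((Real.cos (√μ * ℓ) : ℝ) : 𝕜) • 1))) := by
  have h := isFundamental_trig (𝕜 := 𝕜) hμ
  refine ((eigenspaceEquiv h).trans (kerBoundaryMapEquivOfSinNeZero
    (S := ((Real.sin (√μ * ℓ) / √μ : ℝ) : 𝕜)) (RCLike.ofReal_ne_zero.2 hμ.ne') ?_
    (h.wronskian ℓ) (fun e => by rw [hΓ e]) (fun e => by rw [hΓ e]))).finrank_eq
  exact RCLike.ofReal_ne_zero.2 (div_ne_zero hs (Real.sqrt_pos.2 hμ).ne')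

theorem finrank_eigenspaceOf_of_cos {ℓ μ σ : ℝ} (hΓ : Γ.IsEquilateral ℓ) (hμ : 0 < μ)
    (hσ : σ * σ = 1) (hc : Real.cos (√μ * ℓ) = σ) :
    (Module.finrank 𝕜 (eigenspaceOf (Γ.antiStandardLaplacian 𝕜) (μ : 𝕜)) : ℤ) =
      Fintype.card E - Fintype.card V +
        2 * Module.finrank 𝕜 (LinearMap.ker (Γ.coincidence (σ : 𝕜))) := by
  have h := isFundamental_trig (𝕜 := 𝕜) hμ
  have hs : Real.sin (√μ * ℓ) = 0 := by
    have := Real.sin_sq_add_cos_sq (√μ * ℓ)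
    rw [hc] at this
    exact pow_eq_zero_iff (two_ne_zero) |>.1 (by linear_combination this - hσ)
  have := ((eigenspaceEquiv (Γ := Γ) h).trans (kerBoundaryMapEquivOfSinEqZero (σ := (σ : 𝕜))
    (by exact_mod_cast hσ) (fun e => by rw [hΓ e, hs]; simp)
    (fun e => by rw [hΓ e, hc]))).finrank_eq
  rw [this, Module.finrank_prod]
  push_cast
  rw [finrank_ker_incidence]
  ring

end Eigenspaces

end MetricGraph

/-! ### Assembling the spectrum -/

namespace MetricGraph

variable {V E : Type*} {Γ : MetricGraph V E} {𝕜 : Type*} [RCLike 𝕜] [Fintype V] [Nontrivial V]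
  [Fintype E]

theorem finrank_eigenspaceOf_zero_eq :
    (Module.finrank 𝕜 (eigenspaceOf (Γ.antiStandardLaplacian 𝕜) 0) : ℤ) =
      Fintype.card E - Fintype.card V +
        Module.finrank 𝕜 (LinearMap.ker (Γ.coincidence (1 : 𝕜))) := by
  rw [finrank_eigenspaceOf_zero, finrank_ker_incidence]

theorem finrank_eigenspaceOf_of_cos_eq_neg_one {ℓ μ : ℝ} (hΓ : Γ.IsEquilateral ℓ) (hμ : 0 < μ)
    (hc : Real.cos (√μ * ℓ) = -1) :
    (Module.finrank 𝕜 (eigenspaceOf (Γ.antiStandardLaplacian 𝕜) (μ : 𝕜)) : ℤ) =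
      Fintype.card E - Fintype.card V + 2 := by
  rw [finrank_eigenspaceOf_of_cos hΓ hμ (by norm_num) hc, RCLike.ofReal_neg, RCLike.ofReal_one,
    finrank_ker_coincidence_neg_one]
  norm_num

theorem finrank_eigenspaceOf_of_cos_eq_one {ℓ μ : ℝ} (hΓ : Γ.IsEquilateral ℓ) (hμ : 0 < μ)
    (hc : Real.cos (√μ * ℓ) = 1) :
    (Module.finrank 𝕜 (eigenspaceOf (Γ.antiStandardLaplacian 𝕜) (μ : 𝕜)) : ℤ) =
      Fintype.card E - Fintype.card V +
        2 * Module.finrank 𝕜 (LinearMap.ker (Γ.coincidence (1 : 𝕜))) := by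
  rw [finrank_eigenspaceOf_of_cos hΓ hμ (by norm_num) hc, RCLike.ofReal_one]

omit [Nontrivial V] in
-- For weight `-1` the incidence kernel has dimension `N - n + 1`, which cannot be negative.
theorem card_le_card_add_one (Γ : MetricGraph V E) :
    (Fintype.card V : ℤ) ≤ Fintype.card E + 1 := by
  have h := Γ.finrank_ker_incidence (-1 : ℝ)
  rw [finrank_ker_coincidence_neg_one] at h
  omega

theorem mem_spectrumOf_iff_finrank {z : 𝕜} :
    z ∈ spectrumOf (Γ.antiStandardLaplacian 𝕜) ↔
      Module.finrank 𝕜 (eigenspaceOf (Γ.antiStandardLaplacian 𝕜) z) ≠ 0 := by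
  have := finiteDimensional_eigenspaceOf (Γ := Γ) z
  rw [mem_spectrumOf_iff, Ne, Ne, Submodule.finrank_eq_zero]

theorem zero_mem_spectrumOf_iff :
    (0 : 𝕜) ∈ spectrumOf (Γ.antiStandardLaplacian 𝕜) ↔
      (Γ.graph.IsBipartite → (Fintype.card E - Fintype.card V + 1 : ℤ) ≠ 0) ∧
        (¬ Γ.graph.IsBipartite → (Fintype.card E - Fintype.card V : ℤ) ≠ 0) := by
  have h := finrank_eigenspaceOf_zero_eq (Γ := Γ) (𝕜 := 𝕜)
  rw [mem_spectrumOf_iff_finrank, ← Nat.cast_ne_zero (R := ℤ), h]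
  by_cases hb : Γ.graph.IsBipartite
  · rw [finrank_ker_coincidence_one_of_isBipartite hb]
    simp [hb]
  · rw [finrank_ker_coincidence_one_of_not_isBipartite hb]
    simp [hb]

/-- Only vanishing sine needs care. At cosine `-1` both sides always hold: `N - n + 2 ≥ 1`, and `1`
is an eigenvalue of `Z`. At cosine `1` the first alternative would put `-1` in the spectrum of `Z`,
which is impossible for a non-bipartite graph, so there the condition `N ≠ n` decides. -/
theorem ofReal_mem_spectrumOf_iff [DecidableEq V] {ℓ μ : ℝ} (hΓ : Γ.IsEquilateral ℓ)
    (hμ : 0 < μ) :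
    (μ : 𝕜) ∈ spectrumOf (Γ.antiStandardLaplacian 𝕜) ↔
      ((-Real.cos (ℓ * √μ) : ℝ) : 𝕜) ∈ spectrum 𝕜 (Γ.transition 𝕜) ∨
        Real.cos (ℓ * √μ) = 1 ∧
          (¬ Γ.graph.IsBipartite → (Fintype.card E - Fintype.card V : ℤ) ≠ 0) := by
  have hcard := Γ.card_le_card_add_one
  rw [mem_spectrumOf_iff_finrank, mul_comm ℓ]
  by_cases hs : Real.sin (√μ * ℓ) = 0
  · rcases Real.sin_eq_zero_iff_cos_eq.1 hs with hc | hc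
    · have h := finrank_eigenspaceOf_of_cos_eq_one (𝕜 := 𝕜) hΓ hμ hc
      rw [← Nat.cast_ne_zero (R := ℤ), h, hc]
      by_cases hb : Γ.graph.IsBipartite
      · rw [finrank_ker_coincidence_one_of_isBipartite hb]
        refine iff_of_true ?_ (.inr ⟨rfl, fun h => absurd hb h⟩)
        push_cast
        omega
      · have h1 : ((-1 : ℝ) : 𝕜) ∉ spectrum 𝕜 (Γ.transition 𝕜) := fun h =>
          hb (Γ.isBipartite_of_neg_one_mem_spectrum (by simpa using h))
        rw [finrank_ker_coincidence_one_of_not_isBipartite hb, or_iff_right h1]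
        simp [hb]
    · have h := finrank_eigenspaceOf_of_cos_eq_neg_one (𝕜 := 𝕜) hΓ hμ hc
      rw [← Nat.cast_ne_zero (R := ℤ), h, hc]
      refine iff_of_true (by omega) (.inl ?_)
      rw [neg_neg, RCLike.ofReal_one]
      exact Γ.one_mem_spectrum_transition
  · have hc : Real.cos (√μ * ℓ) ≠ 1 := fun h => hs (Real.sin_eq_zero_iff_cos_eq.2 (.inl h))
    rw [finrank_eigenspaceOf_of_sin_ne_zero hΓ hμ hs, RCLike.ofReal_neg,
      Γ.neg_mem_spectrum_transition_iff]
    simp [hc]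

end MetricGraph

end QuantumGraph

end

open QuantumGraph QuantumGraph.MetricGraph

theorem mainTheorem2 {𝕜 : Type*} [RCLike 𝕜] {V E : Type*} [Fintype V] [DecidableEq V]
    [Nontrivial V] [Fintype E] (Γ : QuantumGraph.MetricGraph V E)
    (ℓ : ℝ) (hΓ : Γ.IsEquilateral ℓ) (N n : ℤ) (hN : N = Fintype.card E)
    (hn : n = Fintype.card V) :
    -- the spectrum: the listed values, without those whose multiplicity is zero
    QuantumGraph.spectrumOf (Γ.antiStandardLaplacian 𝕜) =
      (fun μ : ℝ => (μ : 𝕜)) ''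
        ({μ : ℝ | μ = 0 ∧ (Γ.graph.IsBipartite → N - n + 1 ≠ 0) ∧
            (¬ Γ.graph.IsBipartite → N - n ≠ 0)} ∪
          {μ : ℝ | 0 < μ ∧
            ((-Real.cos (ℓ * Real.sqrt μ) : ℝ) : 𝕜) ∈ spectrum 𝕜 (Γ.transition 𝕜)} ∪
          {μ : ℝ | 0 < μ ∧ Real.cos (ℓ * Real.sqrt μ) = 1 ∧
            (¬ Γ.graph.IsBipartite → N - n ≠ 0)}) ∧
    -- the multiplicities
    (∀ μ : ℝ, FiniteDimensional 𝕜
      (QuantumGraph.eigenspaceOf (Γ.antiStandardLaplacian 𝕜) (μ : 𝕜))) ∧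
    (Γ.graph.IsBipartite →
      (Module.finrank 𝕜 (QuantumGraph.eigenspaceOf (Γ.antiStandardLaplacian 𝕜) 0) : ℤ)
        = N - n + 1) ∧
    (¬ Γ.graph.IsBipartite →
      (Module.finrank 𝕜 (QuantumGraph.eigenspaceOf (Γ.antiStandardLaplacian 𝕜) 0) : ℤ)
        = N - n) ∧
    ∀ μ : ℝ, 0 < μ →
      (Real.sin (Real.sqrt μ * ℓ) ≠ 0 →
        Module.finrank 𝕜 (QuantumGraph.eigenspaceOf (Γ.antiStandardLaplacian 𝕜) (μ : 𝕜)) =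
          Module.finrank 𝕜 (LinearMap.ker (Matrix.toLin'
            (Γ.transition 𝕜 + ((Real.cos (Real.sqrt μ * ℓ) : ℝ) : 𝕜) • 1)))) ∧
      (Real.cos (Real.sqrt μ * ℓ) = -1 →
        (Module.finrank 𝕜 (QuantumGraph.eigenspaceOf (Γ.antiStandardLaplacian 𝕜) (μ : 𝕜)) : ℤ)
          = N - n + 2) ∧
      (Real.cos (Real.sqrt μ * ℓ) = 1 → Γ.graph.IsBipartite →
        (Module.finrank 𝕜 (QuantumGraph.eigenspaceOf (Γ.antiStandardLaplacian 𝕜) (μ : 𝕜)) : ℤ)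
          = N - n + 2) ∧
      (Real.cos (Real.sqrt μ * ℓ) = 1 → ¬ Γ.graph.IsBipartite →
        (Module.finrank 𝕜 (QuantumGraph.eigenspaceOf (Γ.antiStandardLaplacian 𝕜) (μ : 𝕜)) : ℤ)
          = N - n) := by

  subst hN hn
  refine ⟨?_, fun μ => finiteDimensional_eigenspaceOf _, fun hb => ?_, fun hb => ?_,
    fun μ hμ => ⟨fun hs => finrank_eigenspaceOf_of_sin_ne_zero hΓ hμ hs,
      fun hc => finrank_eigenspaceOf_of_cos_eq_neg_one hΓ hμ hc, fun hc hb => ?_,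
      fun hc hb => ?_⟩⟩
  · ext z
    constructor
    · intro hz
      obtain ⟨μ, hμ, rfl⟩ := Γ.eigenvalue_nonneg (mem_spectrumOf_iff.1 hz)
      refine ⟨μ, ?_, rfl⟩
      rcases hμ.eq_or_lt with rfl | hμ
      · rw [RCLike.ofReal_zero] at hz
        exact .inl (.inl ⟨rfl, zero_mem_spectrumOf_iff.1 hz⟩)
      · rcases (ofReal_mem_spectrumOf_iff hΓ hμ).1 hz with h | ⟨h, h'⟩
        · exact .inl (.inr ⟨hμ, h⟩)
        · exact .inr ⟨hμ, h, h'⟩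
    · rintro ⟨μ, (⟨rfl, h⟩ | ⟨hμ, h⟩) | ⟨hμ, h⟩, rfl⟩
      · change ((0 : ℝ) : 𝕜) ∈ _
        rw [RCLike.ofReal_zero]
        exact zero_mem_spectrumOf_iff.2 h
      · exact (ofReal_mem_spectrumOf_iff hΓ hμ).2 (.inl h)
      · exact (ofReal_mem_spectrumOf_iff hΓ hμ).2 (.inr h)
  · rw [finrank_eigenspaceOf_zero_eq, finrank_ker_coincidence_one_of_isBipartite hb]
    norm_num
  · rw [finrank_eigenspaceOf_zero_eq, finrank_ker_coincidence_one_of_not_isBipartite hb]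
    norm_num
  · rw [finrank_eigenspaceOf_of_cos_eq_one hΓ hμ hc, finrank_ker_coincidence_one_of_isBipartite hb]
    norm_num
  · rw [finrank_eigenspaceOf_of_cos_eq_one hΓ hμ hc,
      finrank_ker_coincidence_one_of_not_isBipartite hb]
    norm_num
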